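/- Let $1\le p<2$. A function $L$ is called slowly varying if it is positive and measurable on $[A,\infty)$ for some $A>0$ and $\lim_{x\to\infty}L(\lambda x)/L(x)=1$ for every $\lambda>0$. Let $L:[0,\infty)\to[0,\infty)$ be slowly varying, measurable, and bounded on every bounded interval $[0,b]$; when $p=1$, assume further that $L(x)\ge1$ for all $x\ge0$ and that $L$ is increasing (in the wide sense) on $[0,\infty)$. Let $\tilde L$ be a de Bruijn conjugate of $L$, that is, a slowly varying function with $$\lim_{x\to\infty}L(x)\,\tilde L\big(xL(x)\big)=1\quad\text{and}\quad\lim_{x\to\infty}\tilde L(x)\,L\big(x\tilde L(x)\big)=1 .$$ Let $X_1,X_2,\dots$ be pairwise independent real random variables on a probability space, each with the same distribution as the random variable $X$, and let $S_j=\sum_{i=1}^jX_i$. Then the following three statements are equivalent: (i) $X$ is integrable, $\mathbb E(X)=0$ and $\mathbb E\big(|X|^pL^p(|X|)\big)<\infty$, where $L^p(x)=L(x)^p$; (ii) for every $\alpha\ge1/p$ and every $\varepsilon>0$, $$\sum_{n=1}^\infty n^{\alpha p-2}\,\mathbb P\Big(\max_{1\le j\le n}|S_j|>\varepsilon\,n^\alpha\tilde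 L(n^\alpha)\Big)<\infty;$$ (iii) $\displaystyle\lim_{n\to\infty}\frac{\max_{1\le k\le n}|S_k|}{n^{1/p}\,\tilde L(n^{1/p})}=0$ almost surely. -/

import Mathlib

open MeasureTheory ProbabilityTheory Filter Topology

noncomputable section

/-- A real function is slowly varying (at infinity) if it is positive and measurable on some
half-line `[A, ∞)`, `A > 0`, and `L (c * x) / L x → 1` as `x → ∞` for every `c > 0`. -/
def IsSlowlyVarying (L : ℝ → ℝ) : Prop :=
  (∃ A : ℝ, 0 < A ∧ (∀ x : ℝ, A ≤ x → 0 < L x) ∧ Measurable (fun x : Set.Ici A => L x)) ∧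
    ∀ c : ℝ, 0 < c → Tendsto (fun x : ℝ => L (c * x) / L x) atTop (𝓝 1)

/-- `M` is a de Bruijn conjugate of `L`: it is slowly varying, `L x * M (x * L x) → 1` and
`M x * L (x * M x) → 1` as `x → ∞`. -/
def IsDeBruijnConjugate (L M : ℝ → ℝ) : Prop :=
  IsSlowlyVarying M ∧
    Tendsto (fun x : ℝ => L x * M (x * L x)) atTop (𝓝 1) ∧
    Tendsto (fun x : ℝ => M x * L (x * M x)) atTop (𝓝 1)

/-- The partial sum of the first `j` members of the sequence (which is indexed from `0`). -/
def partialSum {Ω : Type*} (X : ℕ → Ω → ℝ) (j : ℕ) (ω : Ω) : ℝ :=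
  ∑ i ∈ Finset.range j, X i ω

/-- The maximum of `|S_j|` over `0 ≤ j ≤ n`. As `S_0 = 0`, for `n ≥ 1` it is the maximum over
`1 ≤ j ≤ n`. -/
def maxAbsPartialSum {Ω : Type*} (X : ℕ → Ω → ℝ) (n : ℕ) (ω : Ω) : ℝ :=
  (Finset.range (n + 1)).sup' Finset.nonempty_range_add_one (fun j => |partialSum X j ω|)

end

/-! Put `a = 2 ^ α` and `w = a ^ p`. Conjugacy makes `x * Lt x` an asymptotic inverse of `x * L x`,
so the values `c k ≈ a ^ k * Lt (a ^ k)` satisfy: `|X₀| > c k` means, up to constants, `|X₀| * L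
|X₀| > a ^ k`. The moment condition therefore amounts to convergence of `∑ w ^ k * P(|X₀| > c k)`
whenever `α * p ≥ 1` (`IsDyadicNorming.integrable_moment_iff`), and all three statements are
compared through such dyadic series.

From moments to the series, pairwise independence gives additive variances but no Kolmogorov
inequality. The substitute is a chaining argument with truncation at `c k` on scale `2 ^ k`
(`abs_sum_range_le_of_dyadic_blocks`): the binary digits of `j` split `S_j` into complete blocks,
and each change of truncation level on an incomplete block is dominated by its absolute increments
on the complete block. Chebyshev and a union bound over the `2 ^ (m - k)` blocks of each scale give
`measureReal_max_partialSum_le`. Since `p < 2`, the growth rate `ρ < a` of `c` can satisfy `w < ρ ^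
2`, which makes the variance terms a geometric convolution of a summable sequence. The drift is
negligible because tail expectations are `o(c k / 2 ^ k)`: for `p > 1` by growth of `c`, for `p = 1`
by monotonicity of `L`.

The series with `α = 1 / p` yields almost sure convergence by the first Borel–Cantelli lemma along
powers of two. Conversely, almost sure convergence bounds `|X_n|`; Borel–Cantelli for pairwise
independent events returns the tail series, hence the moment. Etemadi's strong law together with `c
m = O(2 ^ m)` then forces mean zero. -/

/-! ### Uniform comparability of slowly varying functions -/

/-- Uniform convergence theorem, additive form, with the bound `1`. -/
theorem exists_forall_abs_shift_sub_le_one {h : ℝ → ℝ} (hm : Measurable h)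
    (hs : ∀ s : ℝ, Tendsto (fun t => h (t + s) - h t) atTop (𝓝 0)) {S : ℝ} (hS : 0 < S) :
    ∃ T : ℝ, ∀ t : ℝ, T ≤ t → ∀ s : ℝ, 0 ≤ s → s ≤ S → |h (t + s) - h t| ≤ 1 := by
  by_contra! hcon
  choose t ht s hs0 hsS hlarge using fun n : ℕ => hcon n
  have ht_top : Tendsto t atTop atTop :=
    tendsto_atTop_mono ht tendsto_natCast_atTop_atTop
  have key : ∀ u : ℕ → ℝ, Tendsto u atTop atTop → ∀ᶠ n in atTop,
      volume (Set.Icc 0 (2 * S) ∩ {x | 1 / 2 ≤ |h (u n + x) - h (u n)|})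
        < ENNReal.ofReal (S / 2) := by
    intro u hu
    have h1 : TendstoInMeasure (volume.restrict (Set.Icc 0 (2 * S)))
        (fun n x => h (u n + x) - h (u n)) atTop (fun _ => (0 : ℝ)) := by
      refine tendstoInMeasure_of_tendsto_ae (fun n => ?_) (ae_of_all _ fun x => ?_)
      · exact ((hm.comp (measurable_const.add measurable_id)).sub_const _).aestronglyMeasurable
      · exact (hs x).comp hu
    have h2 := (tendstoInMeasure_iff_norm.1 h1) (1 / 2) (by norm_num)
    have h3 := h2.eventually_lt_const
      (show (0 : ENNReal) < ENNReal.ofReal (S / 2) by simpa using hS)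
    filter_upwards [h3] with n hn
    rw [Measure.restrict_apply' measurableSet_Icc] at hn
    rw [Set.inter_comm]
    simpa [Real.norm_eq_abs] using hn
  have htop2 : Tendsto (fun n => t n + s n) atTop atTop :=
    tendsto_atTop_mono (fun n => by linarith [hs0 n]) ht_top
  obtain ⟨n, hn1, hn2⟩ := ((key t ht_top).and (key _ htop2)).exists
  set B1 := Set.Icc 0 (2 * S) ∩ {x | 1 / 2 ≤ |h (t n + x) - h (t n)|}
  set B2 := Set.Icc 0 (2 * S) ∩ {x | 1 / 2 ≤ |h (t n + s n + x) - h (t n + s n)|}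
  -- For `x` outside both exceptional sets, `h (t n + x)` is within 1/2 of `h (t n)` and of `h (t n
  -- + s n)`, against the gap larger than 1. So an interval of length `S` is covered by two sets of
  -- measure below `S / 2`.
  have hsub : Set.Icc S (2 * S) ⊆ B1 ∪ (fun x => x + (- s n)) ⁻¹' B2 := by
    intro x hx
    by_contra hxn
    rw [Set.mem_union, not_or] at hxn
    obtain ⟨hx1, hx2⟩ := hxn
    have a1 : |h (t n + x) - h (t n)| < 1 / 2 := by
      by_contra! hc
      exact hx1 ⟨⟨by linarith [hx.1], hx.2⟩, hc⟩
    have a2 : |h (t n + x) - h (t n + s n)| < 1 / 2 := by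
      by_contra! hc
      refine hx2 ⟨⟨by linarith [hx.1, hsS n], by linarith [hx.2, hs0 n]⟩, ?_⟩
      have : t n + s n + (x + - s n) = t n + x := by ring
      simpa only [Set.mem_ofPred_eq, this] using hc
    have a3 := hlarge n
    rw [abs_lt] at a1 a2
    rw [lt_abs] at a3
    rcases a3 with a3 | a3 <;> linarith
  have hvol := (measure_mono (μ := volume) hsub).trans (measure_union_le _ _)
  rw [Real.volume_Icc, measure_preimage_add_right] at hvol
  have := hvol.trans_lt (ENNReal.add_lt_add hn1 hn2)
  rw [← ENNReal.ofReal_add (by linarith) (by linarith)] at this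
  have h4 := (ENNReal.ofReal_lt_ofReal_iff (by linarith)).1 this
  linarith

theorem IsSlowlyVarying.eventually_pos {L : ℝ → ℝ} (hL : IsSlowlyVarying L) :
    ∀ᶠ x in atTop, 0 < L x := by
  obtain ⟨⟨A, -, h, -⟩, -⟩ := hL
  filter_upwards [eventually_ge_atTop A] with x hx using h x hx

/-- Local uniform comparability of a slowly varying function with its dilations. -/
theorem IsSlowlyVarying.eventually_comparable {L : ℝ → ℝ} (hL : IsSlowlyVarying L) {Λ : ℝ}
    (hΛ : 1 < Λ) :
    ∀ᶠ x in atTop, ∀ l : ℝ, 1 ≤ l → l ≤ Λ → L (l * x) ≤ 3 * L x ∧ L x ≤ 3 * L (l * x) := by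
  obtain ⟨⟨A, hA, hpos, hmeas⟩, hlim⟩ := hL
  let h : ℝ → ℝ := fun t => Real.log (L (max (Real.exp t) A))
  have hm : Measurable h := by
    have h0 : Measurable fun t : ℝ =>
        (⟨max (Real.exp t) A, Set.mem_Ici.2 (le_max_right _ _)⟩ : Set.Ici A) :=
      (Real.measurable_exp.max measurable_const).subtype_mk
    exact Real.measurable_log.comp (hmeas.comp h0)
  have hh : ∀ t : ℝ, A ≤ Real.exp t → h t = Real.log (L (Real.exp t)) := by
    intro t ht
    simp only [h, max_eq_left ht]
  have hs : ∀ s : ℝ, Tendsto (fun t => h (t + s) - h t) atTop (𝓝 0) := by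
    intro s
    have h1 := ((hlim (Real.exp s) (Real.exp_pos s)).comp Real.tendsto_exp_atTop).log one_ne_zero
    rw [Real.log_one] at h1
    refine h1.congr' ?_
    filter_upwards [Real.tendsto_exp_atTop.eventually_ge_atTop A,
      (Real.tendsto_exp_atTop.comp (tendsto_atTop_add_const_right atTop s tendsto_id)).eventually_ge_atTop A]
      with t ht ht2
    have ht2' : A ≤ Real.exp (t + s) := ht2
    rw [hh t ht, hh _ ht2', ← Real.log_div (hpos _ ht2').ne' (hpos _ ht).ne']
    simp only [Function.comp]
    rw [Real.exp_add, mul_comm]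
  obtain ⟨T, hT⟩ := exists_forall_abs_shift_sub_le_one hm hs (Real.log_pos hΛ)
  filter_upwards [eventually_ge_atTop (Real.exp T), eventually_ge_atTop A] with x hx hxA l hl1 hl2
  have hx0 : 0 < x := hA.trans_le hxA
  have hl0 : 0 < l := by linarith
  have hlx : A ≤ l * x := hxA.trans (by nlinarith)
  have h1 := hT (Real.log x) ((Real.le_log_iff_exp_le hx0).2 hx) (Real.log l)
    (Real.log_nonneg hl1) (Real.log_le_log hl0 hl2)
  rw [← Real.log_mul hx0.ne' hl0.ne', mul_comm x l,
    hh _ (by rwa [Real.exp_log (by positivity)]), hh _ (by rwa [Real.exp_log hx0]),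
    Real.exp_log hx0, Real.exp_log (by positivity)] at h1
  have hP := hpos _ hxA
  have hQ := hpos _ hlx
  -- An error of 1 in the logarithm is a factor `e`, rounded up to 3.
  have h3 : (1 : ℝ) ≤ Real.log 3 := by
    rw [Real.le_log_iff_exp_le (by norm_num)]
    linarith [Real.exp_one_lt_d9]
  rw [abs_le] at h1
  constructor
  · rw [← Real.log_le_log_iff hQ (by positivity), Real.log_mul (by norm_num) hP.ne']
    linarith
  · rw [← Real.log_le_log_iff hP (by positivity), Real.log_mul (by norm_num) hQ.ne']
    linarith

/-! ### Geometric convolutions and chaining along binary digits -/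

theorem summable_sum_range_mul_pow_sub {a : ℕ → ℝ} (ha : Summable a) (ha0 : ∀ k, 0 ≤ a k)
    {s : ℝ} (hs0 : 0 ≤ s) (hs1 : s < 1) :
    Summable fun m => ∑ k ∈ Finset.range (m + 1), a k * s ^ (m - k) := by
  have h := summable_norm_sum_mul_range_of_summable_norm (f := a) (g := fun k => s ^ k)
    (by simpa only [Real.norm_eq_abs, abs_of_nonneg (ha0 _)] using ha)
    (by simpa only [Real.norm_eq_abs, abs_of_nonneg (pow_nonneg hs0 _)]
      using summable_geometric_of_lt_one hs0 hs1)
  exact h.of_norm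

/-- After reversing the index, each fixed term tends to 0 and is dominated by a geometric series, so
dominated convergence for series applies. -/
theorem tendsto_sum_range_mul_pow_sub {τ : ℕ → ℝ} (hτ : Tendsto τ atTop (𝓝 0))
    {s : ℝ} (hs0 : 0 ≤ s) (hs1 : s < 1) :
    Tendsto (fun m => ∑ k ∈ Finset.range m, τ k * s ^ (m - k)) atTop (𝓝 0) := by
  obtain ⟨C, hC⟩ := hτ.abs.bddAbove_range
  have hC' : ∀ k, |τ k| ≤ C := fun k => hC ⟨k, rfl⟩
  have h := tendsto_tsum_of_dominated_convergence (𝓕 := atTop)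
    (f := fun m j => if j < m then τ (m - 1 - j) * s ^ (j + 1) else 0) (g := fun _ => (0 : ℝ))
    (bound := fun j => C * s ^ (j + 1))
    (((summable_nat_add_iff 1).2 (summable_geometric_of_lt_one hs0 hs1)).mul_left C)
    (fun j => by
      have h1 : Tendsto (fun m => τ (m - 1 - j) * s ^ (j + 1)) atTop (𝓝 (0 * s ^ (j + 1))) :=
        (hτ.comp ((tendsto_sub_atTop_nat j).comp (tendsto_sub_atTop_nat 1))).mul_const _
      rw [zero_mul] at h1
      refine h1.congr' ?_
      filter_upwards [eventually_gt_atTop j] with m hm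
      rw [if_pos hm])
    (Eventually.of_forall fun m j => by
      have hC0 : 0 ≤ C := (abs_nonneg _).trans (hC' 0)
      split_ifs
      · rw [Real.norm_eq_abs, abs_mul, abs_of_nonneg (pow_nonneg hs0 _)]
        exact mul_le_mul_of_nonneg_right (hC' _) (pow_nonneg hs0 _)
      · simpa using mul_nonneg hC0 (pow_nonneg hs0 _))
  rw [tsum_zero] at h
  refine h.congr fun m => ?_
  rw [tsum_eq_sum (s := Finset.range m) (fun j hj => if_neg (by simpa using hj)),
    ← Finset.sum_range_reflect]
  refine Finset.sum_congr rfl fun j hj => ?_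
  have hjm := Finset.mem_range.1 hj
  rw [if_pos (by omega), show m - 1 - (m - 1 - j) = j by omega,
    show m - 1 - j + 1 = m - j by omega]

/-- Deterministic chaining along the dyadic blocks. -/
theorem abs_sum_range_le_of_dyadic_blocks {z d : ℕ → ℕ → ℝ} {e b : ℕ → ℝ}
    (hd : ∀ k i, 0 ≤ d k i) (he : ∀ k, 0 ≤ e k)
    (hzd : ∀ k i, |z (k + 1) i - z k i| ≤ d k i + e k) {m : ℕ}
    (hz : ∀ k < m, ∀ l < 2 ^ (m - k),
      |∑ i ∈ Finset.Ico (2 ^ k * l) (2 ^ k * (l + 1)), z (k + 1) i| ≤ b k)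
    (hdb : ∀ k < m, ∀ l < 2 ^ (m - k),
      |∑ i ∈ Finset.Ico (2 ^ k * l) (2 ^ k * (l + 1)), (d k i - e k)| ≤ b k)
    {j : ℕ} (hj : j < 2 ^ m) :
    |∑ i ∈ Finset.range j, z m i|
      ≤ ∑ k ∈ Finset.range m, (2 * b k + 2 * (2 ^ k * e k)) := by
  -- The last `j mod 2 ^ k` indices are summed at truncation level `k`. Passing to level `k + 1`
  -- costs the increments on an incomplete block, enlarged to the complete one, plus one complete
  -- block when the corresponding binary digit of `j` is 1.
  have key : ∀ k ≤ m, |∑ i ∈ Finset.Ico (2 ^ k * (j / 2 ^ k)) j, z k i|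
      ≤ ∑ k' ∈ Finset.range k, (2 * b k' + 2 * (2 ^ k' * e k')) := by
    intro k
    induction k with
    | zero => simp
    | succ k ih =>
      intro hk
      have ih := ih (by omega)
      have hkm : k < m := hk
      rw [Finset.sum_range_succ]
      set J := j / 2 ^ k with hJ
      have hJlt : J < 2 ^ (m - k) := by
        apply Nat.div_lt_of_lt_mul
        rwa [← pow_add, Nat.add_sub_cancel' hkm.le]
      have hJj : 2 ^ k * J ≤ j := Nat.mul_div_le _ _
      have hjJ : j ≤ 2 ^ k * (J + 1) := (Nat.lt_mul_div_succ j (by positivity)).le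
      have hdiv : j / 2 ^ (k + 1) = J / 2 := by rw [pow_succ, Nat.div_div_eq_div_mul]
      have hres : |∑ i ∈ Finset.Ico (2 ^ k * J) j, z (k + 1) i|
          ≤ |∑ i ∈ Finset.Ico (2 ^ k * J) j, z k i| + (b k + 2 * (2 ^ k * e k)) := by
        have h1 : ∑ i ∈ Finset.Ico (2 ^ k * J) j, z (k + 1) i
            = ∑ i ∈ Finset.Ico (2 ^ k * J) j, z k i
              + ∑ i ∈ Finset.Ico (2 ^ k * J) j, (z (k + 1) i - z k i) := by
          rw [← Finset.sum_add_distrib]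
          exact Finset.sum_congr rfl fun i _ => by ring
        rw [h1]
        refine (abs_add_le _ _).trans (add_le_add le_rfl ?_)
        calc |∑ i ∈ Finset.Ico (2 ^ k * J) j, (z (k + 1) i - z k i)|
            ≤ ∑ i ∈ Finset.Ico (2 ^ k * J) j, (d k i + e k) :=
              (Finset.abs_sum_le_sum_abs _ _).trans (Finset.sum_le_sum fun i _ => hzd k i)
          _ ≤ ∑ i ∈ Finset.Ico (2 ^ k * J) (2 ^ k * (J + 1)), (d k i + e k) :=
              Finset.sum_le_sum_of_subset_of_nonneg (Finset.Ico_subset_Ico le_rfl hjJ)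
                fun i _ _ => add_nonneg (hd k i) (he k)
          _ = ∑ i ∈ Finset.Ico (2 ^ k * J) (2 ^ k * (J + 1)), (d k i - e k)
                + 2 * (2 ^ k * e k) := by
              have h2 : ∀ i, d k i + e k = (d k i - e k) + 2 * e k := fun i => by ring
              simp_rw [h2]
              rw [Finset.sum_add_distrib, Finset.sum_const, Nat.card_Ico,
                show 2 ^ k * (J + 1) - 2 ^ k * J = 2 ^ k by rw [mul_add]; omega, nsmul_eq_mul]
              push_cast
              ring
          _ ≤ b k + 2 * (2 ^ k * e k) :=
              add_le_add ((le_abs_self _).trans (hdb k hkm J hJlt)) le_rfl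
      have hb0 : 0 ≤ b k := (abs_nonneg _).trans (hz k hkm J hJlt)
      rw [hdiv]
      rcases Nat.even_or_odd' J with ⟨q, hq | hq⟩
      · have : 2 ^ (k + 1) * (J / 2) = 2 ^ k * J := by
          rw [hq, pow_succ]
          simp [mul_assoc]
        rw [this]
        linarith
      · have h3 : 2 ^ (k + 1) * (J / 2) = 2 ^ k * (2 * q) := by
          rw [hq, pow_succ, show (2 * q + 1) / 2 = q by omega, mul_assoc]
        have h4 := hz k hkm (2 * q) (by omega)
        rw [← hq] at h4
        rw [h3, ← Finset.sum_Ico_consecutive _ (Nat.mul_le_mul_left _ (by omega)) hJj]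
        refine (abs_add_le _ _).trans ?_
        linarith
  have h := key m le_rfl
  rwa [Nat.div_eq_of_lt hj, mul_zero, ← Finset.range_eq_Ico] at h

/-! ### Covering bounds, Chebyshev and Borel–Cantelli under pairwise independence -/

section probability

variable {Ω : Type*} [MeasurableSpace Ω] {μ : Measure Ω}

/-- Pointwise `|g|` is at most `C` plus the sum of `a k` times the indicator of `A k`; integrating
term by term gives the bound. It serves as a layer-cake estimate with `A k` of the form `{c k <
|X₀|}`. -/
theorem integrable_and_integral_abs_le_of_cover [IsProbabilityMeasure μ] {g : Ω → ℝ}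
    (hg : AEStronglyMeasurable g μ) {A : ℕ → Set Ω} (hA : ∀ k, NullMeasurableSet (A k) μ)
    {a : ℕ → ℝ} (ha : ∀ k, 0 ≤ a k) {C : ℝ} (hC : 0 ≤ C)
    (hs : Summable fun k => a k * μ.real (A k))
    (h : ∀ ω, |g ω| ≤ C ∨ ∃ k, ω ∈ A k ∧ |g ω| ≤ a k) :
    Integrable g μ ∧ ∫ ω, |g ω| ∂μ ≤ C + ∑' k, a k * μ.real (A k) := by
  have hbound : ∫⁻ ω, ‖g ω‖ₑ ∂μ ≤ ENNReal.ofReal (C + ∑' k, a k * μ.real (A k)) := by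
    calc ∫⁻ ω, ‖g ω‖ₑ ∂μ
        ≤ ∫⁻ ω, (ENNReal.ofReal C + ∑' k, (A k).indicator (fun _ => ENNReal.ofReal (a k)) ω) ∂μ := by
          refine lintegral_mono fun ω => ?_
          rw [← ofReal_norm, Real.norm_eq_abs]
          rcases h ω with h1 | ⟨k, hk, h1⟩
          · exact (ENNReal.ofReal_le_ofReal h1).trans le_self_add
          · refine (ENNReal.ofReal_le_ofReal h1).trans (le_trans ?_ le_add_self)
            refine le_trans ?_ (ENNReal.le_tsum k)
            rw [Set.indicator_of_mem hk]
      _ = ENNReal.ofReal C + ∑' k, ENNReal.ofReal (a k * μ.real (A k)) := by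
          rw [lintegral_add_left measurable_const, lintegral_const, measure_univ, mul_one,
            lintegral_tsum fun k => (aemeasurable_const.indicator₀ (hA k))]
          congr 2
          ext k
          rw [lintegral_indicator_const₀ (hA k), ENNReal.ofReal_mul (ha k), Measure.real,
            ENNReal.ofReal_toReal (measure_ne_top _ _)]
      _ = ENNReal.ofReal (C + ∑' k, a k * μ.real (A k)) := by
          have h0 : ∀ k, 0 ≤ a k * μ.real (A k) := fun k => mul_nonneg (ha k) measureReal_nonneg
          rw [ENNReal.ofReal_add hC (tsum_nonneg h0), ENNReal.ofReal_tsum_of_nonneg h0 hs]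
  refine ⟨⟨hg, hbound.trans_lt ENNReal.ofReal_lt_top⟩, ?_⟩
  have h1 := integral_norm_eq_lintegral_enorm hg
  simp only [Real.norm_eq_abs] at h1
  rw [h1]
  refine ENNReal.toReal_le_of_le_ofReal ?_ hbound
  exact add_nonneg hC (tsum_nonneg fun k => mul_nonneg (ha k) measureReal_nonneg)

/-- Chebyshev's inequality for sums of centred bounded functions of pairwise independent identically
distributed variables. -/
theorem measureReal_le_abs_sum_centered_le [IsProbabilityMeasure μ] {X₀ : Ω → ℝ} {X : ℕ → Ω → ℝ}
    (hindep : ∀ i j : ℕ, i ≠ j → IndepFun (X i) (X j) μ)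
    (hident : ∀ n : ℕ, IdentDistrib (X n) X₀ μ μ) {g : ℕ → ℝ → ℝ} (hg : ∀ i, Measurable (g i))
    {C : ℝ} (hgC : ∀ i x, |g i x| ≤ C) (s : Finset ℕ) {t : ℝ} (ht : 0 < t) :
    μ.real {ω | t ≤ |∑ i ∈ s, (g i (X i ω) - ∫ ω, g i (X₀ ω) ∂μ)|}
      ≤ (∑ i ∈ s, ∫ ω, g i (X₀ ω) ^ 2 ∂μ) / t ^ 2 := by
  have hY : ∀ i, IdentDistrib (fun ω => g i (X i ω)) (fun ω => g i (X₀ ω)) μ μ :=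
    fun i => (hident i).comp (hg i)
  have hmem : ∀ i, MemLp (fun ω => g i (X i ω)) 2 μ := fun i =>
    MemLp.of_bound (hY i).aemeasurable_fst.aestronglyMeasurable C
      (ae_of_all _ fun ω => hgC i _)
  have hsum : MemLp (∑ i ∈ s, fun ω => g i (X i ω)) 2 μ := memLp_finsetSum' _ fun i _ => hmem i
  have hE : ∫ ω, (∑ i ∈ s, fun ω => g i (X i ω)) ω ∂μ = ∑ i ∈ s, ∫ ω, g i (X₀ ω) ∂μ := by
    simp only [Finset.sum_apply]
    rw [integral_finsetSum _ fun i _ => (hmem i).integrable (by norm_num)]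
    exact Finset.sum_congr rfl fun i _ => (hY i).integral_eq
  have hV : variance (∑ i ∈ s, fun ω => g i (X i ω)) μ ≤ ∑ i ∈ s, ∫ ω, g i (X₀ ω) ^ 2 ∂μ := by
    rw [IndepFun.variance_sum (fun i _ => hmem i)
      (fun i _ j _ hij => (hindep i j hij).comp (hg i) (hg j))]
    refine Finset.sum_le_sum fun i _ => ?_
    rw [(hY i).variance_eq]
    exact variance_le_expectation_sq (hY i).aemeasurable_snd.aestronglyMeasurable
  have h := meas_ge_le_variance_div_sq hsum ht
  rw [hE] at h
  have hset : {ω | t ≤ |∑ i ∈ s, (g i (X i ω) - ∫ ω, g i (X₀ ω) ∂μ)|}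
      = {ω | t ≤ |(∑ i ∈ s, fun ω => g i (X i ω)) ω - ∑ i ∈ s, ∫ ω, g i (X₀ ω) ∂μ|} := by
    simp only [Finset.sum_sub_distrib, Finset.sum_apply]
  rw [hset]
  calc _ ≤ (ENNReal.ofReal (variance (∑ i ∈ s, fun ω => g i (X i ω)) μ / t ^ 2)).toReal :=
        ENNReal.toReal_mono ENNReal.ofReal_ne_top h
    _ = variance (∑ i ∈ s, fun ω => g i (X i ω)) μ / t ^ 2 :=
        ENNReal.toReal_ofReal (div_nonneg (variance_nonneg _ _) (sq_nonneg _))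
    _ ≤ _ := by gcongr

/-- The second Borel–Cantelli lemma for pairwise independent events, in contrapositive form. -/
theorem summable_measureReal_of_pairwise_indep [IsProbabilityMeasure μ] {X₀ : Ω → ℝ}
    {X : ℕ → Ω → ℝ}
    (hindep : ∀ i j : ℕ, i ≠ j → IndepFun (X i) (X j) μ)
    (hident : ∀ n : ℕ, IdentDistrib (X n) X₀ μ μ) {B : ℕ → Set ℝ}
    (hB : ∀ n, MeasurableSet (B n)) (hev : ∀ᵐ ω ∂μ, ∀ᶠ n in atTop, X n ω ∉ B n) :
    Summable fun n => μ.real (X₀ ⁻¹' B n) := by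
  obtain ⟨M, hM⟩ : ∃ M : ℕ, μ {ω | ∀ i, M ≤ i → X i ω ∉ B i} ≠ 0 := by
    by_contra! hcon
    have h1 : ∀ᵐ ω ∂μ, ∀ M : ℕ, ¬ ∀ i, M ≤ i → X i ω ∉ B i :=
      ae_all_iff.2 fun M => measure_eq_zero_iff_ae_notMem.1 (hcon M)
    obtain ⟨ω, h2, h3⟩ := (h1.and hev).exists
    obtain ⟨M, h4⟩ := eventually_atTop.1 h3
    exact h2 M h4
  set δ := μ.real {ω | ∀ i, M ≤ i → X i ω ∉ B i} with hδ
  have hδ0 : 0 < δ := ENNReal.toReal_pos hM (measure_ne_top _ _)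
  let g : ℕ → ℝ → ℝ := fun i => (B i).indicator fun _ => 1
  have hgint : ∀ i, ∫ ω, g i (X₀ ω) ∂μ = μ.real (X₀ ⁻¹' B i) := by
    intro i
    have h1 : (fun ω => g i (X₀ ω)) = (X₀ ⁻¹' B i).indicator fun _ => (1 : ℝ) := by
      ext ω
      rfl
    rw [h1, integral_indicator₀ ((hident 0).aemeasurable_snd.nullMeasurableSet_preimage (hB i))]
    simp
  have hgsq : ∀ i x, g i x ^ 2 = g i x := by
    intro i x
    by_cases hx : x ∈ B i <;> simp [g, hx]
  have hbound : ∀ n, ∑ i ∈ Finset.Ico M n, μ.real (X₀ ⁻¹' B i) ≤ 1 / δ := by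
    intro n
    set m := ∑ i ∈ Finset.Ico M n, μ.real (X₀ ⁻¹' B i)
    rcases le_or_gt m 0 with hm | hm
    · exact hm.trans (by positivity)
    have h1 := measureReal_le_abs_sum_centered_le hindep hident (g := g)
      (fun i => measurable_const.indicator (hB i)) (C := 1)
      (fun i x => by by_cases hx : x ∈ B i <;> simp [g, hx]) (Finset.Ico M n) hm
    simp only [hgsq, hgint] at h1
    -- On the event of probability `δ` every indicator vanishes, so the centred sum is `-m`. The
    -- second moments of the indicators add up to `m`, and Chebyshev gives `δ ≤ 1 / m`.
    have h2 : δ ≤ m / m ^ 2 := by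
      refine le_trans (measureReal_mono ?_) h1
      intro ω hω
      simp only [Set.mem_ofPred_eq] at hω ⊢
      have h3 : ∑ i ∈ Finset.Ico M n, (g i (X i ω) - μ.real (X₀ ⁻¹' B i)) = - m := by
        rw [Finset.sum_sub_distrib, Finset.sum_eq_zero, zero_sub]
        intro i hi
        simp [g, hω i (Finset.mem_Ico.1 hi).1]
      rw [h3, abs_neg]
      exact le_abs_self _
    rw [pow_two, div_mul_cancel_left₀ hm.ne'] at h2
    rw [one_div]
    exact (le_inv_comm₀ hδ0 hm).1 h2
  refine summable_of_sum_range_le (c := ∑ i ∈ Finset.range M, μ.real (X₀ ⁻¹' B i) + 1 / δ)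
    (fun _ => measureReal_nonneg) fun n => ?_
  refine le_trans ?_ (add_le_add le_rfl (hbound n))
  rcases le_total M n with h | h
  · rw [Finset.sum_range_add_sum_Ico _ h]
  · exact (Finset.sum_le_sum_of_subset_of_nonneg (Finset.range_mono h)
      fun _ _ _ => measureReal_nonneg).trans
        (le_add_of_nonneg_right (Finset.sum_nonneg fun _ _ => measureReal_nonneg))

end probability

/-! ### Truncation and geometric growth -/

/-- Truncation of a real number to zero outside `[-c, c]`. -/
noncomputable def truncAt (c x : ℝ) : ℝ := if |x| ≤ c then x else 0

/-- The part of `|x|` cut off by the truncation at level `c`. -/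
noncomputable def tailAbs (c x : ℝ) : ℝ := if |x| ≤ c then 0 else |x|

theorem measurable_truncAt (c : ℝ) : Measurable (truncAt c) :=
  Measurable.ite (measurableSet_le (by fun_prop) measurable_const) measurable_id measurable_const

theorem measurable_tailAbs (c : ℝ) : Measurable (tailAbs c) :=
  Measurable.ite (measurableSet_le (by fun_prop) measurable_const) measurable_const (by fun_prop)

theorem tailAbs_nonneg (c x : ℝ) : 0 ≤ tailAbs c x := by
  unfold tailAbs; split_ifs <;> simp

theorem tailAbs_le (c x : ℝ) : tailAbs c x ≤ |x| := by
  unfold tailAbs; split_ifs <;> simp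

theorem abs_truncAt_le {c : ℝ} (hc : 0 ≤ c) (x : ℝ) : |truncAt c x| ≤ c := by
  unfold truncAt; split_ifs with h
  · exact h
  · simpa using hc

theorem abs_sub_truncAt (c x : ℝ) : |x - truncAt c x| = tailAbs c x := by
  unfold truncAt tailAbs; split_ifs <;> simp

theorem abs_truncAt_sub_truncAt_le_tailAbs (c c' x : ℝ) (h : c ≤ c') :
    |truncAt c' x - truncAt c x| ≤ tailAbs c x := by
  unfold truncAt tailAbs; split_ifs <;> first | linarith | simp

theorem truncAt_sub_truncAt_sq_le (c c' x : ℝ) (h : c ≤ c') :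
    |truncAt c' x - truncAt c x| ^ 2 ≤ truncAt c' x ^ 2 := by
  unfold truncAt
  split_ifs
  · simpa using sq_nonneg x
  · simp
  · linarith
  · simp

section growth

variable {c : ℕ → ℝ} {ρ : ℝ}

theorem pow_mul_le_of_ratio (hρ0 : 0 ≤ ρ) (hρ : ∀ k, ρ * c k ≤ c (k + 1)) {i k : ℕ} (hik : i ≤ k) :
    ρ ^ (k - i) * c i ≤ c k := by
  induction k, hik using Nat.le_induction with
  | base => simp
  | succ k hik ih =>
    rw [Nat.succ_sub hik, pow_succ]
    calc ρ ^ (k - i) * ρ * c i = ρ * (ρ ^ (k - i) * c i) := by ring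
      _ ≤ ρ * c k := mul_le_mul_of_nonneg_left ih hρ0
      _ ≤ _ := hρ k

theorem sum_range_pow_sub_le {r : ℝ} (hr0 : 0 ≤ r) (hr1 : r < 1) (m : ℕ) :
    ∑ k ∈ Finset.range m, r ^ (m - k) ≤ 1 / (1 - r) := by
  induction m with
  | zero => simpa using hr1.le
  | succ m ih =>
    rw [Finset.sum_range_succ]
    have h1 : ∑ k ∈ Finset.range m, r ^ (m + 1 - k) = r * ∑ k ∈ Finset.range m, r ^ (m - k) := by
      rw [Finset.mul_sum]
      refine Finset.sum_congr rfl fun k hk => ?_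
      rw [Nat.succ_sub (Finset.mem_range.1 hk).le, pow_succ']
    rw [h1, Nat.add_sub_cancel_left, pow_one]
    have h2 : 0 < 1 - r := by linarith
    rw [le_div_iff₀ h2] at ih ⊢
    nlinarith [sq_nonneg (1 - r), mul_le_mul_of_nonneg_left ih hr0]

end growth

/-! ### The maximal inequality and its dyadic summation -/

section probability

variable {Ω : Type*} [MeasurableSpace Ω] {μ : Measure Ω}

theorem nullMeasurableSet_lt_abs {X₀ : Ω → ℝ} (hX : AEMeasurable X₀ μ) (t : ℝ) :
    NullMeasurableSet {ω | t < |X₀ ω|} μ :=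
  nullMeasurableSet_lt aemeasurable_const (by fun_prop)

/-- Summability of the normalized truncated second moments. -/
theorem summable_truncated_second_moment [IsProbabilityMeasure μ] {X₀ : Ω → ℝ}
    (hX : AEMeasurable X₀ μ) {c : ℕ → ℝ} (hc0 : ∀ k, 0 < c k) {w ρ : ℝ} (hw : 0 < w) (hρ1 : 1 < ρ)
    (hwρ : w < ρ ^ 2) (hρ : ∀ k, ρ * c k ≤ c (k + 1))
    (hB : Summable fun k => w ^ k * μ.real {ω | c k < |X₀ ω|}) :
    Summable fun k => w ^ k * (∫ ω, truncAt (c k) (X₀ ω) ^ 2 ∂μ) / c k ^ 2 := by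
  set P : ℕ → ℝ := fun k => μ.real {ω | c k < |X₀ ω|} with hP
  have hρ0 : 0 < ρ := by linarith
  set θ := w / ρ ^ 2 with hθ
  have hθ0 : 0 < θ := by positivity
  have hθ1 : θ < 1 := (div_lt_one (by positivity)).2 hwρ
  -- Let `N` be the first index with `|X₀| ≤ c N`. Either `N = 0`, or `N = i + 1` and the square is
  -- at most `c (i + 1) ^ 2` on `{c i < |X₀|}`.
  have hv : ∀ k, ∫ ω, truncAt (c k) (X₀ ω) ^ 2 ∂μ
      ≤ c 0 ^ 2 + ∑ i ∈ Finset.range k, c (i + 1) ^ 2 * P i := by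
    intro k
    have h := integrable_and_integral_abs_le_of_cover (μ := μ)
      (g := fun ω => truncAt (c k) (X₀ ω) ^ 2)
      (((measurable_truncAt _).comp_aemeasurable hX).pow_const 2).aestronglyMeasurable
      (fun i => nullMeasurableSet_lt_abs hX (c i))
      (a := fun i => if i < k then c (i + 1) ^ 2 else 0)
      (fun i => by split_ifs <;> positivity) (sq_nonneg (c 0))
      (summable_of_ne_finset_zero (s := Finset.range k) fun i hi => by
        rw [if_neg (by simpa using hi), zero_mul])
      (fun ω => by
        rw [abs_of_nonneg (sq_nonneg _)]
        by_cases hk : |X₀ ω| ≤ c k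
        · have hex : ∃ i, |X₀ ω| ≤ c i := ⟨k, hk⟩
          classical
          have h1 := Nat.find_spec hex
          have h2 : Nat.find hex ≤ k := Nat.find_min' hex hk
          rw [truncAt, if_pos hk]
          rcases hN : Nat.find hex with _ | i
          · left
            rw [hN] at h1
            rw [← sq_abs]
            exact pow_le_pow_left₀ (abs_nonneg _) h1 2
          · right
            rw [hN] at h1 h2
            refine ⟨i, ?_, ?_⟩
            · have := Nat.find_min hex (m := i) (by omega)
              simpa using this
            · rw [if_pos (by omega), ← sq_abs]
              exact pow_le_pow_left₀ (abs_nonneg _) h1 2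
        · left
          rw [truncAt, if_neg hk]
          simpa using sq_nonneg (c 0))
    have h2 := h.2
    simp only [abs_sq] at h2
    refine h2.trans (add_le_add le_rfl (le_of_eq ?_))
    rw [tsum_eq_sum (s := Finset.range k) fun i hi => by
        rw [if_neg (by simpa using hi), zero_mul]]
    exact Finset.sum_congr rfl fun i hi => by rw [if_pos (Finset.mem_range.1 hi)]
  have hconv := summable_sum_range_mul_pow_sub hB
    (fun k => mul_nonneg (pow_nonneg hw.le _) measureReal_nonneg) hθ0.le hθ1
  refine Summable.of_nonneg_of_le (fun k => ?_) (fun k => ?_)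
    ((summable_geometric_of_lt_one hθ0.le hθ1).add (hconv.mul_left (ρ ^ 2)))
  · have : 0 ≤ ∫ ω, truncAt (c k) (X₀ ω) ^ 2 ∂μ := integral_nonneg fun ω => sq_nonneg _
    exact div_nonneg (mul_nonneg (pow_nonneg hw.le _) this) (sq_nonneg _)
  · have hck := hc0 k
    -- Growth of `c` by at least `ρ` per step turns the weights into powers of `θ < 1`, so the
    -- double sum becomes a convolution with a geometric sequence.
    have hterm : ∀ i ≤ k, w ^ k * c i ^ 2 / c k ^ 2 ≤ w ^ i * θ ^ (k - i) := by
      intro i hi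
      have h1 := pow_mul_le_of_ratio hρ0.le hρ hi
      have h3 : w ^ k = w ^ i * w ^ (k - i) := by rw [← pow_add, Nat.add_sub_cancel' hi]
      rw [hθ, div_pow, div_le_iff₀ (by positivity), h3, ← pow_mul, mul_comm 2, pow_mul]
      have h4 : (ρ ^ (k - i)) ^ 2 * c i ^ 2 ≤ c k ^ 2 := by
        rw [← mul_pow]
        exact pow_le_pow_left₀ (mul_nonneg (by positivity) (hc0 i).le) h1 2
      have h5 : 0 < (ρ ^ (k - i)) ^ 2 := by positivity
      calc w ^ i * w ^ (k - i) * c i ^ 2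
          = w ^ i * (w ^ (k - i) / (ρ ^ (k - i)) ^ 2) * ((ρ ^ (k - i)) ^ 2 * c i ^ 2) := by
            field_simp
        _ ≤ _ := mul_le_mul_of_nonneg_left h4 (by positivity)
    calc w ^ k * (∫ ω, truncAt (c k) (X₀ ω) ^ 2 ∂μ) / c k ^ 2
        ≤ w ^ k * (c 0 ^ 2 + ∑ i ∈ Finset.range k, c (i + 1) ^ 2 * P i) / c k ^ 2 := by
          gcongr
          exact hv k
      _ = w ^ k * c 0 ^ 2 / c k ^ 2
          + ∑ i ∈ Finset.range k, (w ^ k * c (i + 1) ^ 2 / c k ^ 2) * P i := by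
          rw [mul_add, add_div, Finset.mul_sum, Finset.sum_div]
          congr 1
          exact Finset.sum_congr rfl fun i _ => by ring
      _ ≤ θ ^ k + ∑ i ∈ Finset.range k, ρ ^ 2 * (w ^ i * P i * θ ^ (k - i)) := by
          refine add_le_add (by simpa using hterm 0 (Nat.zero_le _))
            (Finset.sum_le_sum fun i hi => ?_)
          have hik := Finset.mem_range.1 hi
          have h6 : w ^ (i + 1) * θ ^ (k - (i + 1)) = ρ ^ 2 * (w ^ i * θ ^ (k - i)) := by
            rw [show k - i = (k - (i + 1)) + 1 by omega, pow_succ θ, hθ, pow_succ]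
            field_simp
          calc _ ≤ w ^ (i + 1) * θ ^ (k - (i + 1)) * P i :=
                mul_le_mul_of_nonneg_right (hterm (i + 1) hik) measureReal_nonneg
            _ = _ := by rw [h6]; ring
      _ ≤ θ ^ k + ρ ^ 2 * ∑ i ∈ Finset.range (k + 1), w ^ i * P i * θ ^ (k - i) := by
          rw [← Finset.mul_sum, Finset.sum_range_succ]
          gcongr
          refine le_add_of_nonneg_right ?_
          have : 0 ≤ P k := measureReal_nonneg
          positivity

/-- Union bound for the maximum of the partial sums over a dyadic range. -/
theorem measureReal_max_partialSum_le [IsProbabilityMeasure μ] {X₀ : Ω → ℝ} {X : ℕ → Ω → ℝ}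
    (hindep : ∀ i j : ℕ, i ≠ j → IndepFun (X i) (X j) μ)
    (hident : ∀ n : ℕ, IdentDistrib (X n) X₀ μ μ) (hint : Integrable X₀ μ)
    (hmean : ∫ ω, X₀ ω ∂μ = 0) {c : ℕ → ℝ} (hc0 : ∀ k, 0 < c k) (hmono : ∀ k, c k ≤ c (k + 1))
    {b : ℕ → ℝ} (hb : ∀ k, 0 < b k) {m : ℕ} {T : ℝ}
    (hT : ∑ k ∈ Finset.range m, (2 * b k + 2 * (2 ^ k * ∫ ω, tailAbs (c k) (X₀ ω) ∂μ))
      + 2 ^ m * ∫ ω, tailAbs (c m) (X₀ ω) ∂μ ≤ T) :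
    μ.real {ω | ∃ j < 2 ^ m, T < |partialSum X j ω|}
      ≤ 2 ^ m * μ.real {ω | c m < |X₀ ω|}
        + ∑ k ∈ Finset.range m,
          2 * 2 ^ m * (∫ ω, truncAt (c (k + 1)) (X₀ ω) ^ 2 ∂μ) / b k ^ 2 := by
  have hX : AEMeasurable X₀ μ := (hident 0).aemeasurable_snd
  let D : ℕ → ℝ → ℝ := fun k x => |truncAt (c (k + 1)) x - truncAt (c k) x|
  have hDm : ∀ k, Measurable (D k) := fun k =>
    ((measurable_truncAt _).sub (measurable_truncAt _)).abs
  have htail_int : ∀ k, Integrable (fun ω => tailAbs (c k) (X₀ ω)) μ := fun k =>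
    hint.mono ((measurable_tailAbs _).comp_aemeasurable hX).aestronglyMeasurable
      (ae_of_all _ fun ω => by
        rw [Real.norm_eq_abs, Real.norm_eq_abs, abs_of_nonneg (tailAbs_nonneg _ _)]
        exact tailAbs_le _ _)
  have htr_int : ∀ k, Integrable (fun ω => truncAt (c k) (X₀ ω)) μ := fun k =>
    Integrable.of_bound ((measurable_truncAt _).comp_aemeasurable hX).aestronglyMeasurable (c k)
      (ae_of_all _ fun ω => abs_truncAt_le (hc0 k).le _)
  have hD_int : ∀ k, Integrable (fun ω => D k (X₀ ω)) μ := fun k =>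
    ((htr_int (k + 1)).sub (htr_int k)).abs
  have hD_le : ∀ k, ∫ ω, D k (X₀ ω) ∂μ ≤ ∫ ω, tailAbs (c k) (X₀ ω) ∂μ := fun k =>
    integral_mono (hD_int k) (htail_int k) fun ω =>
      abs_truncAt_sub_truncAt_le_tailAbs _ _ _ (hmono k)
  let z : Ω → ℕ → ℕ → ℝ := fun ω k i => truncAt (c k) (X i ω) - ∫ ω, truncAt (c k) (X₀ ω) ∂μ
  let e : ℕ → ℝ := fun k => ∫ ω, D k (X₀ ω) ∂μ
  let blk : ℕ → ℕ → Finset ℕ := fun k l => Finset.Ico (2 ^ k * l) (2 ^ k * (l + 1))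
  let B0 : ℕ → Set Ω := fun i => {ω | c m < |X i ω|}
  let B1 : ℕ → ℕ → Set Ω := fun k l => {ω | b k ≤ |∑ i ∈ blk k l, z ω (k + 1) i|}
  let B2 : ℕ → ℕ → Set Ω := fun k l => {ω | b k ≤ |∑ i ∈ blk k l, (D k (X i ω) - e k)|}
  have hcard : ∀ k l, ((blk k l).card : ℝ) = 2 ^ k := by
    intro k l
    rw [Nat.card_Ico, show 2 ^ k * (l + 1) - 2 ^ k * l = 2 ^ k by rw [mul_add]; omega]
    push_cast
    rfl
  -- Off `B0` the partial sums equal the truncated ones. Off `B1` and `B2` the chaining bound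
  -- controls the centred part, and only the drift of the truncated means remains.
  have hsub : {ω | ∃ j < 2 ^ m, T < |partialSum X j ω|} ⊆
      (⋃ i ∈ Finset.range (2 ^ m), B0 i) ∪
        ⋃ k ∈ Finset.range m, ⋃ l ∈ Finset.range (2 ^ (m - k)), (B1 k l ∪ B2 k l) := by
    rintro ω ⟨j, hj, hjT⟩
    by_contra hω
    simp only [Set.mem_union, Set.mem_iUnion, Finset.mem_range, not_or, not_exists] at hω
    obtain ⟨h0, h12⟩ := hω
    have h0' : ∀ i < 2 ^ m, |X i ω| ≤ c m := fun i hi => not_lt.1 (h0 i hi)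
    have hz : ∀ k i, |z ω (k + 1) i - z ω k i| ≤ D k (X i ω) + e k := by
      intro k i
      have h1 : z ω (k + 1) i - z ω k i = (truncAt (c (k + 1)) (X i ω) - truncAt (c k) (X i ω))
          - ∫ ω, (truncAt (c (k + 1)) (X₀ ω) - truncAt (c k) (X₀ ω)) ∂μ := by
        rw [integral_sub (htr_int _) (htr_int _)]
        simp only [z]
        ring
      rw [h1]
      exact (abs_sub _ _).trans (add_le_add le_rfl (abs_integral_le_integral_abs))
    have hch := abs_sum_range_le_of_dyadic_blocks (z := z ω) (d := fun k i => D k (X i ω)) (e := e)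
      (b := b) (fun k i => abs_nonneg _) (fun k => integral_nonneg fun ω => abs_nonneg _) hz
      (m := m) (fun k hk l hl => (not_le.1 (h12 k hk l hl).1).le)
      (fun k hk l hl => (not_le.1 (h12 k hk l hl).2).le) hj
    have hS : partialSum X j ω = ∑ i ∈ Finset.range j, z ω m i
        + j * ∫ ω, truncAt (c m) (X₀ ω) ∂μ := by
      simp only [z, partialSum, Finset.sum_sub_distrib, Finset.sum_const, Finset.card_range,
        nsmul_eq_mul, sub_add_cancel]
      refine Finset.sum_congr rfl fun i hi => ?_
      rw [truncAt, if_pos (h0' i ((Finset.mem_range.1 hi).trans hj))]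
    -- Mean zero turns the truncated mean into minus the mean of the part cut off.
    have hEm : |∫ ω, truncAt (c m) (X₀ ω) ∂μ| ≤ ∫ ω, tailAbs (c m) (X₀ ω) ∂μ := by
      have h1 : ∫ ω, truncAt (c m) (X₀ ω) ∂μ = - ∫ ω, (X₀ ω - truncAt (c m) (X₀ ω)) ∂μ := by
        rw [integral_sub hint (htr_int _), hmean]
        ring
      rw [h1, abs_neg]
      refine (abs_integral_le_integral_abs).trans (le_of_eq ?_)
      simp_rw [abs_sub_truncAt]
    have hjm : (j : ℝ) ≤ 2 ^ m := by exact_mod_cast hj.le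
    have h2 : |partialSum X j ω| ≤ T := by
      refine le_trans ?_ hT
      rw [hS]
      refine (abs_add_le _ _).trans (add_le_add (hch.trans (Finset.sum_le_sum fun k _ => ?_)) ?_)
      · gcongr
        exact hD_le k
      · rw [abs_mul, Nat.abs_cast]
        gcongr
    exact absurd hjT (not_lt.2 h2)
  have hP0 : ∀ i, μ.real (B0 i) = μ.real {ω | c m < |X₀ ω|} := by
    intro i
    have := ((hident i).norm).measure_mem_eq (measurableSet_Ioi (a := c m))
    exact congrArg ENNReal.toReal this
  have hP1 : ∀ k l, μ.real (B1 k l)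
      ≤ 2 ^ k * (∫ ω, truncAt (c (k + 1)) (X₀ ω) ^ 2 ∂μ) / b k ^ 2 := by
    intro k l
    have h := measureReal_le_abs_sum_centered_le hindep hident
      (g := fun _ => truncAt (c (k + 1))) (fun _ => measurable_truncAt _)
      (fun _ => abs_truncAt_le (hc0 (k + 1)).le) (blk k l) (hb k)
    rwa [Finset.sum_const, nsmul_eq_mul, hcard] at h
  have hP2 : ∀ k l, μ.real (B2 k l)
      ≤ 2 ^ k * (∫ ω, truncAt (c (k + 1)) (X₀ ω) ^ 2 ∂μ) / b k ^ 2 := by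
    intro k l
    have h := measureReal_le_abs_sum_centered_le hindep hident
      (g := fun _ => D k) (fun _ => hDm k) (C := c (k + 1) + c k)
      (fun _ x => by
        rw [abs_abs]
        exact (abs_sub _ _).trans (add_le_add (abs_truncAt_le (hc0 _).le _)
          (abs_truncAt_le (hc0 _).le _))) (blk k l) (hb k)
    rw [Finset.sum_const, nsmul_eq_mul, hcard] at h
    refine h.trans ?_
    -- A level change is either 0 or the value truncated at the higher level, so `B2` obeys the same
    -- bound as `B1`.
    have h1 : ∫ ω, D k (X₀ ω) ^ 2 ∂μ ≤ ∫ ω, truncAt (c (k + 1)) (X₀ ω) ^ 2 ∂μ := by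
      refine integral_mono_of_nonneg (ae_of_all _ fun ω => sq_nonneg _) ?_
        (ae_of_all _ fun ω => truncAt_sub_truncAt_sq_le _ _ _ (hmono k))
      refine Integrable.of_bound
        ((measurable_truncAt _).comp_aemeasurable hX |>.pow_const 2).aestronglyMeasurable
        (c (k + 1) ^ 2) (ae_of_all _ fun ω => ?_)
      rw [norm_pow]
      exact pow_le_pow_left₀ (norm_nonneg _) (abs_truncAt_le (hc0 (k + 1)).le _) 2
    exact div_le_div_of_nonneg_right (mul_le_mul_of_nonneg_left h1 (by positivity)) (sq_nonneg _)
  calc μ.real {ω | ∃ j < 2 ^ m, T < |partialSum X j ω|}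
      ≤ μ.real (⋃ i ∈ Finset.range (2 ^ m), B0 i) + μ.real
        (⋃ k ∈ Finset.range m, ⋃ l ∈ Finset.range (2 ^ (m - k)), (B1 k l ∪ B2 k l)) :=
        (measureReal_mono hsub).trans (measureReal_union_le _ _)
    _ ≤ ∑ i ∈ Finset.range (2 ^ m), μ.real (B0 i) + ∑ k ∈ Finset.range m,
          ∑ l ∈ Finset.range (2 ^ (m - k)), (μ.real (B1 k l) + μ.real (B2 k l)) := by
        refine add_le_add (measureReal_biUnion_finset_le _ _)
          ((measureReal_biUnion_finset_le _ _).trans (Finset.sum_le_sum fun k _ => ?_))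
        exact (measureReal_biUnion_finset_le _ _).trans
          (Finset.sum_le_sum fun l _ => measureReal_union_le _ _)
    _ ≤ _ := by
        simp only [hP0, Finset.sum_const, Finset.card_range, nsmul_eq_mul]
        push_cast
        refine add_le_add le_rfl (Finset.sum_le_sum fun k hk => ?_)
        have h1 : (2 : ℝ) ^ m = 2 ^ (m - k) * 2 ^ k := by
          rw [← pow_add, Nat.sub_add_cancel (Finset.mem_range.1 hk).le]
        calc _ ≤ ∑ l ∈ Finset.range (2 ^ (m - k)),
              2 * (2 ^ k * (∫ ω, truncAt (c (k + 1)) (X₀ ω) ^ 2 ∂μ) / b k ^ 2) :=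
              Finset.sum_le_sum fun l _ => by linarith [hP1 k l, hP2 k l]
          _ = _ := by
              rw [Finset.sum_const, Finset.card_range, nsmul_eq_mul, h1]
              push_cast
              ring

/-- The maximal inequality is applied with thresholds `b k = η * c m * r ^ (m - k)`. They decay
slowly enough for Chebyshev to remain summable, yet their sum is a small multiple of `c m`. -/
theorem summable_dyadic_max_partialSum [IsProbabilityMeasure μ] {X₀ : Ω → ℝ} {X : ℕ → Ω → ℝ}
    (hindep : ∀ i j : ℕ, i ≠ j → IndepFun (X i) (X j) μ)
    (hident : ∀ n : ℕ, IdentDistrib (X n) X₀ μ μ) (hint : Integrable X₀ μ)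
    (hmean : ∫ ω, X₀ ω ∂μ = 0) {c : ℕ → ℝ} (hc0 : ∀ k, 0 < c k) {w ρ : ℝ} (hw : 0 < w)
    (hρ1 : 1 < ρ) (hwρ : w < ρ ^ 2) (hρ : ∀ k, ρ * c k ≤ c (k + 1))
    (hB : Summable fun k => w ^ k * μ.real {ω | c k < |X₀ ω|})
    (hC : Tendsto (fun k => 2 ^ k * (∫ ω, tailAbs (c k) (X₀ ω) ∂μ) / c k) atTop (𝓝 0))
    {ε : ℝ} (hε : 0 < ε) :
    Summable fun m => (w / 2) ^ m * μ.real {ω | ∃ j < 2 ^ m, ε * c m < |partialSum X j ω|} := by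
  have hV := summable_truncated_second_moment (hident 0).aemeasurable_snd hc0 hw hρ1 hwρ hρ hB
  have hρ0 : 0 < ρ := by linarith
  set v : ℕ → ℝ := fun k => ∫ ω, truncAt (c k) (X₀ ω) ^ 2 ∂μ with hv
  have hv0 : ∀ k, 0 ≤ v k := fun k => integral_nonneg fun ω => sq_nonneg _
  set E : ℕ → ℝ := fun k => ∫ ω, tailAbs (c k) (X₀ ω) ∂μ with hE
  have hE0 : ∀ k, 0 ≤ E k := fun k => integral_nonneg fun ω => tailAbs_nonneg _ _
  set τ : ℕ → ℝ := fun k => 2 ^ k * E k / c k with hτ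
  have hτ0 : ∀ k, 0 ≤ τ k := fun k => div_nonneg (mul_nonneg (by positivity) (hE0 k)) (hc0 k).le
  have hτE : ∀ k, 2 ^ k * E k = τ k * c k := fun k => (div_mul_cancel₀ _ (hc0 k).ne').symm
  -- With `θ = w / ρ ^ 2`, the variance terms decay like `θ ^ (m - k)`. Squared thresholds with `r =
  -- θ ^ (1/4)` give back `θ ^ (-(m - k) / 2)`, leaving the summable factor `s ^ (m - k)`.
  set s := √(w / ρ ^ 2) with hs
  have hθ0 : 0 < w / ρ ^ 2 := by positivity
  have hs0 : 0 < s := Real.sqrt_pos.2 hθ0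
  have hs1 : s < 1 := by
    rw [hs, Real.sqrt_lt' one_pos, one_pow]
    exact (div_lt_one (by positivity)).2 hwρ
  have hs2 : s ^ 2 = w / ρ ^ 2 := Real.sq_sqrt hθ0.le
  set r := √s with hr
  have hr0 : 0 < r := Real.sqrt_pos.2 hs0
  have hr1 : r < 1 := by rw [hr, Real.sqrt_lt' one_pos, one_pow]; exact hs1
  have hr2 : r ^ 2 = s := Real.sq_sqrt hs0.le
  set η := ε * (1 - r) / 8 with hη
  have hη0 : 0 < η := by
    have : 0 < 1 - r := by linarith
    positivity
  have hinv0 : 0 ≤ 1 / ρ := by positivity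
  have hinv1 : 1 / ρ < 1 := (div_lt_one hρ0).2 hρ1
  have hconvτ := tendsto_sum_range_mul_pow_sub hC hinv0 hinv1
  have hconvV := summable_sum_range_mul_pow_sub ((summable_nat_add_iff 1).2 hV)
    (fun k => div_nonneg (mul_nonneg (pow_nonneg hw.le _) (hv0 _)) (sq_nonneg _)) hs0.le hs1
  refine Summable.of_norm_bounded_eventually_nat
    (hB.add (hconvV.mul_left (2 / (η ^ 2 * s ^ 2)))) ?_
  filter_upwards [hconvτ.eventually_le_const (show (0 : ℝ) < ε / 8 by positivity),
    hC.eventually_le_const (show (0 : ℝ) < ε / 4 by positivity)] with m hm1 hm2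
  rw [Real.norm_of_nonneg (mul_nonneg (by positivity) measureReal_nonneg)]
  have hcm := hc0 m
  have hT : ∑ k ∈ Finset.range m, (2 * (η * c m * r ^ (m - k)) + 2 * (2 ^ k * E k))
      + 2 ^ m * E m ≤ ε * c m := by
    rw [Finset.sum_add_distrib]
    have h1 : ∑ k ∈ Finset.range m, 2 * (η * c m * r ^ (m - k)) ≤ ε / 4 * c m := by
      rw [← Finset.mul_sum, ← Finset.mul_sum]
      calc _ ≤ 2 * (η * c m * (1 / (1 - r))) := by
            have := sum_range_pow_sub_le hr0.le hr1 m
            gcongr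
        _ = _ := by
            rw [hη]
            have : 1 - r ≠ 0 := by linarith
            field_simp
            ring
    have h2 : ∑ k ∈ Finset.range m, 2 * (2 ^ k * E k) ≤ ε / 4 * c m := by
      calc _ ≤ ∑ k ∈ Finset.range m, 2 * (τ k * (1 / ρ) ^ (m - k) * c m) := by
            refine Finset.sum_le_sum fun k hk => ?_
            rw [hτE, mul_assoc (τ k)]
            have h3 := pow_mul_le_of_ratio hρ0.le hρ (Finset.mem_range.1 hk).le
            have h4 : c k ≤ (1 / ρ) ^ (m - k) * c m := by
              rw [one_div, inv_pow, inv_mul_eq_div, le_div_iff₀ (by positivity), mul_comm]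
              exact h3
            have := mul_le_mul_of_nonneg_left h4 (hτ0 k)
            linarith
        _ = 2 * (∑ k ∈ Finset.range m, τ k * (1 / ρ) ^ (m - k)) * c m := by
            rw [Finset.mul_sum, Finset.sum_mul]
            exact Finset.sum_congr rfl fun k _ => by ring
        _ ≤ _ := by
            have := mul_le_mul_of_nonneg_right hm1 hcm.le
            linarith
    have h3 : 2 ^ m * E m ≤ ε / 4 * c m := by
      rw [hτE]
      exact mul_le_mul_of_nonneg_right hm2 hcm.le
    linarith [mul_pos hε hcm]
  have hmain := measureReal_max_partialSum_le hindep hident hint hmean hc0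
    (fun k => (le_mul_of_one_le_left (hc0 k).le hρ1.le).trans (hρ k))
    (b := fun k => η * c m * r ^ (m - k)) (fun k => by positivity) hT
  calc _ ≤ (w / 2) ^ m * (2 ^ m * μ.real {ω | c m < |X₀ ω|} + ∑ k ∈ Finset.range m,
          2 * 2 ^ m * v (k + 1) / (η * c m * r ^ (m - k)) ^ 2) := by gcongr
    _ = w ^ m * μ.real {ω | c m < |X₀ ω|} + ∑ k ∈ Finset.range m,
          2 * w ^ m * v (k + 1) / (η * c m * r ^ (m - k)) ^ 2 := by
        have h1 : (w / 2) ^ m * 2 ^ m = w ^ m := by rw [← mul_pow]; simp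
        rw [mul_add, ← mul_assoc, h1, Finset.mul_sum]
        congr 1
        refine Finset.sum_congr rfl fun k _ => ?_
        rw [← h1]
        ring
    _ ≤ w ^ m * μ.real {ω | c m < |X₀ ω|} + 2 / (η ^ 2 * s ^ 2) * ∑ k ∈ Finset.range m,
          w ^ (k + 1) * v (k + 1) / c (k + 1) ^ 2 * s ^ (m - k) := by
        rw [Finset.mul_sum]
        refine add_le_add le_rfl (Finset.sum_le_sum fun k hk => ?_)
        have hkm : k + 1 ≤ m := Finset.mem_range.1 hk
        obtain ⟨n, rfl⟩ := Nat.exists_eq_add_of_le hkm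
        have h3 := pow_mul_le_of_ratio hρ0.le hρ hkm
        rw [show k + 1 + n - (k + 1) = n by omega] at h3
        rw [show k + 1 + n - k = n + 1 by omega]
        have hck := hc0 (k + 1)
        have h4 : (η * c (k + 1 + n) * r ^ (n + 1)) ^ 2
            = η ^ 2 * s ^ (n + 1) * c (k + 1 + n) ^ 2 := by
          rw [mul_pow, mul_pow, ← pow_mul, mul_comm (n + 1), pow_mul, hr2]
          ring
        have h5 : (ρ ^ 2) ^ n * c (k + 1) ^ 2 ≤ c (k + 1 + n) ^ 2 := by
          rw [← pow_mul, mul_comm 2, pow_mul, ← mul_pow]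
          exact pow_le_pow_left₀ (by positivity) h3 2
        have h6 : w = s ^ 2 * ρ ^ 2 := by rw [hs2]; field_simp
        rw [h4]
        calc 2 * w ^ (k + 1 + n) * v (k + 1) / (η ^ 2 * s ^ (n + 1) * c (k + 1 + n) ^ 2)
            ≤ 2 * w ^ (k + 1 + n) * v (k + 1)
              / (η ^ 2 * s ^ (n + 1) * ((ρ ^ 2) ^ n * c (k + 1) ^ 2)) := by
              have := hv0 (k + 1)
              gcongr
          _ = _ := by
              rw [pow_add w, show w ^ n = (s ^ n) ^ 2 * (ρ ^ 2) ^ n by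
                rw [h6]; ring, pow_succ s]
              field_simp
    _ ≤ _ := by
        rw [Finset.sum_range_succ _ m]
        gcongr
        refine le_add_of_nonneg_right ?_
        have := hv0 (m + 1)
        positivity

end probability

/-! ### The dyadic norming sequence -/

/-- A sequence that is eventually positive with ratios tending to `a` agrees eventually with a
positive sequence whose ratios are all at least a given `ρ < a`. -/
theorem exists_eventuallyEq_forall_ratio_le {c : ℕ → ℝ} (hc : ∀ᶠ k in atTop, 0 < c k) {a ρ : ℝ}
    (hρ0 : 0 < ρ) (hρa : ρ < a) (hratio : Tendsto (fun k => c (k + 1) / c k) atTop (𝓝 a)) :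
    ∃ c' : ℕ → ℝ, (∀ k, 0 < c' k) ∧ (∀ k, ρ * c' k ≤ c' (k + 1)) ∧ ∀ᶠ k in atTop, c' k = c k := by
  obtain ⟨N, hN⟩ := eventually_atTop.1 (hc.and (hratio.eventually_const_le hρa))
  refine ⟨fun k => if N ≤ k then c k else c N / ρ ^ (N - k), fun k => ?_, fun k => ?_, ?_⟩
  · dsimp only
    split_ifs with h
    · exact (hN k h).1
    · exact div_pos (hN N le_rfl).1 (by positivity)
  · dsimp only
    rcases lt_trichotomy (k + 1) N with h | h | h
    · rw [if_neg (by omega), if_neg (by omega), show N - k = N - (k + 1) + 1 by omega, pow_succ]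
      apply le_of_eq
      field_simp
    · rw [if_neg (by omega), if_pos (by omega), show N - k = 1 by omega, h, pow_one]
      apply le_of_eq
      field_simp
    · have hk : N ≤ k := by omega
      rw [if_pos hk, if_pos (by omega), ← le_div_iff₀ (hN k hk).1]
      exact (hN k hk).2
  · filter_upwards [eventually_ge_atTop N] with k hk
    rw [if_pos hk]

/-- `c` is a regularization of the dyadic values `a ^ k * M (a ^ k)` of the norming function
`x * M x`. -/
structure IsDyadicNorming (L M : ℝ → ℝ) (a ρ : ℝ) (c : ℕ → ℝ) : Prop where
  pos : ∀ k, 0 < c k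
  ratio_ge : ∀ k, ρ * c k ≤ c (k + 1)
  eventually_eq : ∀ᶠ k in atTop, c k = a ^ k * M (a ^ k)
  tendsto_ratio : Tendsto (fun k => c (k + 1) / c k) atTop (𝓝 a)
  tendsto_atTop : Tendsto c atTop atTop
  comparable : ∀ᶠ k in atTop, ∀ x : ℝ, a ^ k ≤ x → x ≤ a ^ (k + 1) →
    x * M x ≤ 3 * a * c k ∧ c k ≤ 3 * (x * M x)
  inverse : ∀ᶠ k in atTop, ∀ x : ℝ, c k ≤ x → x ≤ c (k + 1) →
    a ^ k ≤ 6 * (x * L x) ∧ x * L x ≤ 12 * a * a ^ k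

/-- Slow variation of `M` makes the dyadic ratios tend to `a`. For `inverse`, conjugacy places `c k
* L (c k)` between `a ^ k / 2` and `2 * a ^ k`. Moving from `c k` to `x ≤ 2 * a * c k` costs at most
3 in `L` and `2 * a` in the argument, whence 6 and `12 * a`. -/
theorem exists_isDyadicNorming {L M : ℝ → ℝ} (hL : IsSlowlyVarying L)
    (hM : IsDeBruijnConjugate L M) {a ρ : ℝ} (hρ1 : 1 < ρ) (hρa : ρ < a) :
    ∃ c, IsDyadicNorming L M a ρ c := by
  obtain ⟨hMs, -, hML⟩ := hM
  have ha1 : 1 < a := hρ1.trans hρa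
  have ha0 : 0 < a := by linarith
  have hpow : Tendsto (fun k : ℕ => a ^ k) atTop atTop := tendsto_pow_atTop_atTop_of_one_lt ha1
  have hMpos := hpow.eventually hMs.eventually_pos
  have hpos0 : ∀ᶠ k : ℕ in atTop, 0 < a ^ k * M (a ^ k) := by
    filter_upwards [hMpos] with k hk
    positivity
  have hratio0 : Tendsto (fun k : ℕ => (a ^ (k + 1) * M (a ^ (k + 1))) / (a ^ k * M (a ^ k)))
      atTop (𝓝 a) := by
    have h := ((hMs.2 a ha0).comp hpow).const_mul a
    rw [mul_one] at h
    refine h.congr' ?_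
    filter_upwards [hMpos] with k hk
    simp only [Function.comp]
    rw [pow_succ', mul_div_mul_comm, mul_div_assoc, div_self (by positivity), mul_one]
  obtain ⟨c, hc0, hcρ, hceq⟩ := exists_eventuallyEq_forall_ratio_le hpos0 (by linarith) hρa hratio0
  have htop : Tendsto c atTop atTop := by
    refine tendsto_atTop_mono (fun k => ?_)
      ((tendsto_pow_atTop_atTop_of_one_lt hρ1).atTop_mul_const (hc0 0))
    simpa using pow_mul_le_of_ratio (by linarith) hcρ (Nat.zero_le k)
  have hratio : Tendsto (fun k => c (k + 1) / c k) atTop (𝓝 a) := by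
    refine hratio0.congr' ?_
    filter_upwards [hceq, (tendsto_add_atTop_nat 1).eventually hceq] with k h1 h2
    rw [h1, h2]
  refine ⟨c, hc0, hcρ, hceq, hratio, htop, ?_, ?_⟩
  · filter_upwards [hpow.eventually (hMs.eventually_comparable ha1), hceq, hMpos] with k hk hck hMk
      x hx1 hx2
    have hak : 0 < a ^ k := by positivity
    obtain ⟨h1, h2⟩ := hk (x / a ^ k) ((one_le_div hak).2 hx1)
      ((div_le_iff₀ hak).2 (by rwa [pow_succ'] at hx2))
    rw [div_mul_cancel₀ _ hak.ne'] at h1 h2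
    rw [hck]
    have hx0 : 0 < x := hak.trans_le hx1
    constructor
    · calc x * M x ≤ x * (3 * M (a ^ k)) := mul_le_mul_of_nonneg_left h1 hx0.le
        _ ≤ a ^ (k + 1) * (3 * M (a ^ k)) := mul_le_mul_of_nonneg_right hx2 (by positivity)
        _ = _ := by ring
    · calc a ^ k * M (a ^ k) ≤ x * M (a ^ k) := mul_le_mul_of_nonneg_right hx1 hMk.le
        _ ≤ x * (3 * M x) := mul_le_mul_of_nonneg_left h2 hx0.le
        _ = _ := by ring
  · have hML' := hML.comp hpow
    filter_upwards [htop.eventually (hL.eventually_comparable (show 1 < 2 * a by linarith)), hceq,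
      htop.eventually hL.eventually_pos, hratio.eventually_le_const (show a < 2 * a by linarith),
      hML'.eventually_const_le (show (1 / 2 : ℝ) < 1 by norm_num),
      hML'.eventually_le_const (show (1 : ℝ) < 2 by norm_num)] with k hk hck hLk hr h1 h2 x hx1 hx2
    simp only [Function.comp] at h1 h2
    rw [← hck] at h1 h2
    have hak : 0 < a ^ k := by positivity
    have hck0 := hc0 k
    have hx0 : 0 < x := hck0.trans_le hx1
    have hxr : x ≤ 2 * a * c k := hx2.trans ((div_le_iff₀ hck0).1 hr)
    obtain ⟨h3, h4⟩ := hk (x / c k) ((one_le_div hck0).2 hx1) ((div_le_iff₀ hck0).2 hxr)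
    rw [div_mul_cancel₀ _ hck0.ne'] at h3 h4
    have h5 : c k * L (c k) = a ^ k * (M (a ^ k) * L (c k)) := by rw [← mul_assoc, ← hck]
    constructor
    · calc a ^ k = 2 * (a ^ k * (1 / 2)) := by ring
        _ ≤ 2 * (c k * L (c k)) := by rw [h5]; gcongr
        _ ≤ 2 * (x * (3 * L x)) := by
            have := mul_le_mul hx1 h4 hLk.le hx0.le
            linarith
        _ = _ := by ring
    · calc x * L x ≤ x * (3 * L (c k)) := mul_le_mul_of_nonneg_left h3 hx0.le
        _ ≤ 2 * a * c k * (3 * L (c k)) := mul_le_mul_of_nonneg_right hxr (by positivity)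
        _ = 6 * a * (c k * L (c k)) := by ring
        _ ≤ 6 * a * (a ^ k * 2) := by rw [h5]; gcongr
        _ = _ := by ring

theorem exists_ge_lt_and_le_succ {c : ℕ → ℝ} (hc : Tendsto c atTop atTop) {k : ℕ} {x : ℝ}
    (h : c k < x) : ∃ i, c (k + i) < x ∧ x ≤ c (k + i + 1) := by
  have hex : ∃ i, x ≤ c (k + i) := by
    obtain ⟨n, hn, hkn⟩ := ((hc.eventually_ge_atTop x).and (eventually_ge_atTop k)).exists
    exact ⟨n - k, by rwa [Nat.add_sub_cancel' hkn]⟩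
  classical
  rcases hN : Nat.find hex with _ | i
  · have := Nat.find_spec hex
    rw [hN] at this
    exact absurd h (not_lt.2 this)
  · have h1 := Nat.find_spec hex
    rw [hN] at h1
    exact ⟨i, not_le.1 (Nat.find_min hex (by omega)), h1⟩

theorem sum_range_succ_pow_le {w : ℝ} (hw : 2 ≤ w) (n : ℕ) :
    ∑ k ∈ Finset.range (n + 1), w ^ k ≤ 2 * w ^ n := by
  induction n with
  | zero => simp
  | succ n ih =>
    rw [Finset.sum_range_succ, pow_succ]
    have : 0 ≤ w ^ n := by positivity
    nlinarith

/-! ### Tail series, moments and tail expectations -/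

section probability

variable {Ω : Type*} [MeasurableSpace Ω] {μ : Measure Ω}

/-- Integrability of `F |X₀|` gives convergence of the weighted tail sum. -/
theorem summable_pow_mul_tail_of_integrable [IsProbabilityMeasure μ] {X₀ : Ω → ℝ}
    (hX : AEMeasurable X₀ μ) {c : ℕ → ℝ} (hcm : Monotone c) (hctop : Tendsto c atTop atTop)
    {w : ℝ} (hw : 2 ≤ w) {F : ℝ → ℝ} (hF0 : ∀ x, 0 ≤ x → 0 ≤ F x) {C : ℝ} (hC : 0 ≤ C)
    (hF : ∀ᶠ k in atTop, ∀ x, c k ≤ x → x ≤ c (k + 1) → w ^ k ≤ C * F x)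
    (hint : Integrable (fun ω => F |X₀ ω|) μ) :
    Summable fun k => w ^ k * μ.real {ω | c k < |X₀ ω|} := by
  obtain ⟨K, hK⟩ := eventually_atTop.1 hF
  have hw0 : 0 < w := by linarith
  set W := ∑ k ∈ Finset.range K, w ^ k
  have hW : 0 ≤ W := Finset.sum_nonneg fun k _ => by positivity
  -- Since `w ≥ 2`, the sum of `w ^ k` over `c k < x` is at most twice its last term, which `F x`
  -- controls. `W` absorbs the indices below `K`, where no comparison is available.
  have hpt : ∀ N x, 0 ≤ x → ∑ k ∈ Finset.range N, (if c k < x then w ^ k else 0)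
      ≤ W + 2 * C * F x := by
    intro N x hx
    by_cases hxK : c K < x
    · obtain ⟨i, hi1, hi2⟩ := exists_ge_lt_and_le_succ hctop hxK
      calc ∑ k ∈ Finset.range N, (if c k < x then w ^ k else 0)
          ≤ ∑ k ∈ Finset.range (K + i + 1), w ^ k := by
            rw [← Finset.sum_filter]
            refine Finset.sum_le_sum_of_subset_of_nonneg (fun k hk => ?_)
              fun _ _ _ => by positivity
            have h1 := (Finset.mem_filter.1 hk).2
            by_contra h2
            have h3 : K + i + 1 ≤ k := by simpa using h2
            exact absurd h1 (not_lt.2 (hi2.trans (hcm h3)))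
        _ ≤ 2 * w ^ (K + i) := sum_range_succ_pow_le hw _
        _ ≤ 2 * (C * F x) := by
            have := hK (K + i) (by omega) x hi1.le hi2
            linarith
        _ ≤ _ := by linarith
    · calc ∑ k ∈ Finset.range N, (if c k < x then w ^ k else 0) ≤ W := by
            rw [← Finset.sum_filter]
            refine Finset.sum_le_sum_of_subset_of_nonneg (fun k hk => ?_)
              fun _ _ _ => by positivity
            have h1 := (Finset.mem_filter.1 hk).2
            by_contra h2
            have h3 : K ≤ k := by simpa using h2
            exact hxK ((hcm h3).trans_lt h1)
        _ ≤ _ := le_add_of_nonneg_right (mul_nonneg (by positivity) (hF0 x hx))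
  have hnull : ∀ k, NullMeasurableSet {ω | c k < |X₀ ω|} μ := fun k => nullMeasurableSet_lt_abs hX _
  have hterm : ∀ k, Integrable ({ω | c k < |X₀ ω|}.indicator fun _ => w ^ k) μ := fun k =>
    (integrable_const _).indicator₀ (hnull k)
  refine summable_of_sum_range_le (c := ∫ ω, (W + 2 * C * F |X₀ ω|) ∂μ)
    (fun k => mul_nonneg (by positivity) measureReal_nonneg) fun N => ?_
  have h1 : ∑ k ∈ Finset.range N, w ^ k * μ.real {ω | c k < |X₀ ω|}
      = ∫ ω, ∑ k ∈ Finset.range N, {ω | c k < |X₀ ω|}.indicator (fun _ => w ^ k) ω ∂μ := by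
    rw [integral_finsetSum _ fun k _ => hterm k]
    refine Finset.sum_congr rfl fun k _ => ?_
    rw [integral_indicator₀ (hnull k)]
    simp [mul_comm]
  rw [h1]
  refine integral_mono (integrable_finsetSum _ fun k _ => hterm k)
    ((integrable_const _).add (hint.const_mul _)) fun ω => ?_
  refine le_trans (le_of_eq ?_) (hpt N |X₀ ω| (abs_nonneg _))
  exact Finset.sum_congr rfl fun k _ => by simp [Set.indicator_apply]

/-- Convergence of the weighted tail sum gives integrability of `F |X₀|`. -/
theorem integrable_of_summable_pow_mul_tail [IsProbabilityMeasure μ] {X₀ : Ω → ℝ}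
    (hX : AEMeasurable X₀ μ) {c : ℕ → ℝ} (hctop : Tendsto c atTop atTop)
    {w : ℝ} (hw : 0 ≤ w) {F : ℝ → ℝ} (hF0 : ∀ x, 0 ≤ x → 0 ≤ F x)
    (hFm : Measurable fun x => F |x|) (hFb : ∀ b, ∃ B, ∀ x, 0 ≤ x → x ≤ b → F x ≤ B)
    {C : ℝ} (hC : 0 ≤ C)
    (hF : ∀ᶠ k in atTop, ∀ x, c k ≤ x → x ≤ c (k + 1) → F x ≤ C * w ^ k)
    (hsum : Summable fun k => w ^ k * μ.real {ω | c k < |X₀ ω|}) :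
    Integrable (fun ω => F |X₀ ω|) μ := by
  obtain ⟨K, hK⟩ := eventually_atTop.1 hF
  obtain ⟨B, hB⟩ := hFb (c K)
  refine (integrable_and_integral_abs_le_of_cover (hFm.comp_aemeasurable hX).aestronglyMeasurable
    (fun k => nullMeasurableSet_lt_abs hX (c k)) (a := fun k => C * w ^ k)
    (fun k => by positivity) (C := max B 0) (le_max_right _ _)
    (by simpa only [mul_assoc] using hsum.mul_left C) fun ω => ?_).1
  rw [Function.comp_apply, abs_of_nonneg (hF0 _ (abs_nonneg _))]
  by_cases h : c K < |X₀ ω|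
  · obtain ⟨i, h1, h2⟩ := exists_ge_lt_and_le_succ hctop h
    exact Or.inr ⟨K + i, h1, hK (K + i) (by omega) _ h1.le h2⟩
  · exact Or.inl ((hB _ (abs_nonneg _) (not_lt.1 h)).trans (le_max_left _ _))

/-- On `c (k + i) < |X₀| ≤ c (k + i + 1)` the variable is at most `w ^ (i + 1) * c k`; the covering
bound sums these layers. -/
theorem integrable_tailAbs_and_integral_le [IsProbabilityMeasure μ] {X₀ : Ω → ℝ}
    (hX : AEMeasurable X₀ μ) {c : ℕ → ℝ} (hc0 : ∀ k, 0 < c k) (hctop : Tendsto c atTop atTop)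
    {w : ℝ} (hw : 0 < w) {k : ℕ} (hk : ∀ j, k ≤ j → c (j + 1) ≤ w * c j)
    (hsum : Summable fun k => w ^ k * μ.real {ω | c k < |X₀ ω|}) :
    Integrable (fun ω => tailAbs (c k) (X₀ ω)) μ ∧
      ∫ ω, tailAbs (c k) (X₀ ω) ∂μ
        ≤ c k * w / w ^ k * ∑' i, w ^ (i + k) * μ.real {ω | c (i + k) < |X₀ ω|} := by
  have hgrow : ∀ i, c (k + i) ≤ w ^ i * c k := by
    intro i
    induction i with
    | zero => simp
    | succ i ih =>
      calc c (k + i + 1) ≤ w * c (k + i) := hk _ (by omega)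
        _ ≤ w * (w ^ i * c k) := mul_le_mul_of_nonneg_left ih hw.le
        _ = _ := by ring
  have heq : ∀ i, c k * w ^ (i + 1) * μ.real {ω | c (k + i) < |X₀ ω|}
      = c k * w / w ^ k * (w ^ (i + k) * μ.real {ω | c (i + k) < |X₀ ω|}) := by
    intro i
    rw [add_comm k i, pow_add, pow_add, pow_one]
    field_simp
  have h := integrable_and_integral_abs_le_of_cover (μ := μ)
    (g := fun ω => tailAbs (c k) (X₀ ω))
    ((measurable_tailAbs _).comp_aemeasurable hX).aestronglyMeasurable
    (fun i => nullMeasurableSet_lt_abs hX (c (k + i))) (a := fun i => c k * w ^ (i + 1))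
    (fun i => mul_nonneg (hc0 k).le (by positivity)) (C := 0) le_rfl
    (by
      simp_rw [heq]
      exact ((summable_nat_add_iff k).2 hsum).mul_left _)
    (fun ω => by
      rw [abs_of_nonneg (tailAbs_nonneg _ _), tailAbs]
      split_ifs with h1
      · exact Or.inl le_rfl
      · obtain ⟨i, h2, h3⟩ := exists_ge_lt_and_le_succ hctop (not_le.1 h1)
        refine Or.inr ⟨i, h2, h3.trans ?_⟩
        have := hgrow (i + 1)
        rw [mul_comm]
        exact this)
  refine ⟨h.1, ?_⟩
  have h2 := h.2
  simp only [abs_of_nonneg (tailAbs_nonneg _ _), zero_add, heq, tsum_mul_left] at h2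
  exact h2

/-- Negligibility of the tail expectations when the norming sequence grows at most like `w ^ k`. -/
theorem tendsto_tail_of_ratio_le [IsProbabilityMeasure μ] {X₀ : Ω → ℝ}
    (hX : AEMeasurable X₀ μ) {c : ℕ → ℝ} (hc0 : ∀ k, 0 < c k) (hctop : Tendsto c atTop atTop)
    {w : ℝ} (hw : 2 ≤ w) (hr : ∀ᶠ j in atTop, c (j + 1) ≤ w * c j)
    (hsum : Summable fun k => w ^ k * μ.real {ω | c k < |X₀ ω|}) :
    Tendsto (fun k => 2 ^ k * (∫ ω, tailAbs (c k) (X₀ ω) ∂μ) / c k) atTop (𝓝 0) := by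
  obtain ⟨K, hK⟩ := eventually_atTop.1 hr
  have hw0 : 0 < w := by linarith
  -- As `2 ^ k ≤ w ^ k`, the quantity is at most `w` times the remainder of a convergent series.
  have htail := (tendsto_sum_nat_add fun k => w ^ k * μ.real {ω | c k < |X₀ ω|}).const_mul w
  rw [mul_zero] at htail
  refine squeeze_zero' (Eventually.of_forall fun k => ?_) ?_ htail
  · have : 0 ≤ ∫ ω, tailAbs (c k) (X₀ ω) ∂μ := integral_nonneg fun ω => tailAbs_nonneg _ _
    have := hc0 k
    positivity
  · filter_upwards [eventually_ge_atTop K] with k hk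
    have h := (integrable_tailAbs_and_integral_le hX hc0 hctop hw0
      (fun j hj => hK j (hk.trans hj)) hsum).2
    have hck := hc0 k
    set R := ∑' i, w ^ (i + k) * μ.real {ω | c (i + k) < |X₀ ω|}
    have hR : 0 ≤ R := tsum_nonneg fun i => mul_nonneg (by positivity) measureReal_nonneg
    rw [div_le_iff₀ hck]
    calc _ ≤ 2 ^ k * (c k * w / w ^ k * R) := by gcongr
      _ = 2 ^ k / w ^ k * (c k * w * R) := by ring
      _ ≤ 1 * (c k * w * R) := by
          gcongr
          rw [div_le_one (by positivity)]
          gcongr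
      _ = _ := by ring

/-- Negligibility of the tail expectations under `E |X₀| L(|X₀|) < ∞` with `L` monotone. -/
theorem tendsto_tail_of_monotoneOn {X₀ : Ω → ℝ}
    (hX : AEMeasurable X₀ μ) {c : ℕ → ℝ} (hc0 : ∀ k, 0 < c k) (hctop : Tendsto c atTop atTop)
    {L : ℝ → ℝ} (hL1 : ∀ x, 0 ≤ x → 1 ≤ L x) (hLm : MonotoneOn L (Set.Ici 0))
    (hcL : ∀ᶠ k in atTop, 2 ^ k ≤ 6 * (c k * L (c k)))
    (hint : Integrable (fun ω => |X₀ ω| * L |X₀ ω|) μ) :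
    Tendsto (fun k => 2 ^ k * (∫ ω, tailAbs (c k) (X₀ ω) ∂μ) / c k) atTop (𝓝 0) := by
  let G : ℕ → Ω → ℝ := fun k => {ω | c k < |X₀ ω|}.indicator fun ω => |X₀ ω| * L |X₀ ω|
  have hGint : ∀ k, Integrable (G k) μ := fun k => hint.indicator₀ (nullMeasurableSet_lt_abs hX _)
  have hpos : ∀ ω, 0 ≤ |X₀ ω| * L |X₀ ω| := fun ω =>
    mul_nonneg (abs_nonneg _) (zero_le_one.trans (hL1 _ (abs_nonneg _)))
  have hG : Tendsto (fun k => ∫ ω, G k ω ∂μ) atTop (𝓝 0) := by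
    have h := tendsto_integral_of_dominated_convergence (μ := μ) (F := G) (f := fun _ => 0)
      (fun ω => |X₀ ω| * L |X₀ ω|) (fun k => (hGint k).1) hint
      (fun k => ae_of_all _ fun ω => by
        rw [Real.norm_eq_abs]
        by_cases h : c k < |X₀ ω|
        · simp only [G, Set.indicator_of_mem (show ω ∈ {ω | c k < |X₀ ω|} from h),
            abs_of_nonneg (hpos ω), le_refl]
        · simp only [G, Set.indicator_of_notMem (show ω ∉ {ω | c k < |X₀ ω|} from h), abs_zero,
            hpos ω])
      (ae_of_all _ fun ω => by
        refine tendsto_const_nhds.congr' ?_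
        filter_upwards [hctop.eventually_ge_atTop |X₀ ω|] with k hk
        simp only [G, Set.indicator_of_notMem (show ω ∉ {ω | c k < |X₀ ω|} from not_lt.2 hk)])
    simpa using h
  have hG6 := hG.const_mul 6
  rw [mul_zero] at hG6
  refine squeeze_zero' (Eventually.of_forall fun k => ?_) ?_ hG6
  · have : 0 ≤ ∫ ω, tailAbs (c k) (X₀ ω) ∂μ := integral_nonneg fun ω => tailAbs_nonneg _ _
    have := hc0 k
    positivity
  · filter_upwards [hcL] with k hk
    have hck := hc0 k
    have hLk : 0 < L (c k) := zero_lt_one.trans_le (hL1 _ hck.le)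
    -- On `{c k < |X₀|}` monotonicity gives `L (c k) ≤ L |X₀|`. The factor `1 / L (c k)` is then
    -- absorbed by `2 ^ k ≤ 6 * (c k * L (c k))`.
    have hle : ∫ ω, tailAbs (c k) (X₀ ω) ∂μ ≤ (1 / L (c k)) * ∫ ω, G k ω ∂μ := by
      rw [← integral_const_mul]
      refine integral_mono_of_nonneg (ae_of_all _ fun ω => tailAbs_nonneg _ _)
        ((hGint k).const_mul _) (ae_of_all _ fun ω => ?_)
      dsimp only
      by_cases h : c k < |X₀ ω|
      · rw [tailAbs, if_neg (not_le.2 h)]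
        simp only [G, Set.indicator_of_mem (show ω ∈ {ω | c k < |X₀ ω|} from h)]
        rw [one_div, inv_mul_eq_div, le_div_iff₀ hLk]
        exact mul_le_mul_of_nonneg_left (hLm (Set.mem_Ici.2 hck.le) (Set.mem_Ici.2 (abs_nonneg _)) h.le) (abs_nonneg _)
      · rw [tailAbs, if_pos (not_lt.1 h)]
        simp only [G, Set.indicator_of_notMem (show ω ∉ {ω | c k < |X₀ ω|} from h), mul_zero,
          le_refl]
    have hI : 0 ≤ ∫ ω, G k ω ∂μ :=
      integral_nonneg fun ω => Set.indicator_nonneg (fun ω _ => hpos ω) ω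
    rw [div_le_iff₀ hck]
    calc _ ≤ 2 ^ k * ((1 / L (c k)) * ∫ ω, G k ω ∂μ) := by gcongr
      _ ≤ 6 * (c k * L (c k)) * ((1 / L (c k)) * ∫ ω, G k ω ∂μ) := by gcongr
      _ = _ := by field_simp

end probability

/-! ### Passage between series over integers and dyadic series -/

section dyadic

theorem eventually_log_of_eventually_block {Q : ℕ → ℕ → Prop}
    (h : ∀ᶠ m in atTop, ∀ n, 2 ^ m ≤ n → n < 2 ^ (m + 1) → Q m n) :
    ∀ᶠ n in atTop, Q (Nat.log 2 n) n := by
  obtain ⟨M, hM⟩ := eventually_atTop.1 h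
  filter_upwards [eventually_ge_atTop (2 ^ M)] with n hn
  have hn0 : n ≠ 0 := by
    have : 0 < 2 ^ M := by positivity
    omega
  exact hM _ (Nat.le_log_of_pow_le (by norm_num) hn) n (Nat.pow_log_le_self 2 hn0)
    (Nat.lt_pow_succ_log_self (by norm_num) n)

theorem sum_range_two_pow_succ (f : ℕ → ℝ) (N : ℕ) :
    ∑ n ∈ Finset.range (2 ^ (N + 1)), f n
      = ∑ n ∈ Finset.range (2 ^ N), f n + ∑ n ∈ Finset.Ico (2 ^ N) (2 ^ (N + 1)), f n :=
  (Finset.sum_range_add_sum_Ico _ (Nat.pow_le_pow_right (by norm_num) (by omega))).symm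

theorem card_Ico_two_pow (N : ℕ) : (((Finset.Ico (2 ^ N) (2 ^ (N + 1))).card : ℕ) : ℝ) = 2 ^ N := by
  rw [Nat.card_Ico, pow_succ, show 2 ^ N * 2 - 2 ^ N = 2 ^ N by omega]
  push_cast
  rfl

/-- The block from `2 ^ m` to `2 ^ (m + 1)` has `2 ^ m` terms, so the termwise bound makes its sum
at most `g m`. This is condensation without monotonicity of `f`. -/
theorem summable_of_dyadic_block_le {f g : ℕ → ℝ} (hf : ∀ n, 0 ≤ f n) (hg : ∀ m, 0 ≤ g m)
    (hs : Summable g)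
    (h : ∀ᶠ m in atTop, ∀ n, 2 ^ m ≤ n → n < 2 ^ (m + 1) → 2 ^ m * f n ≤ g m) :
    Summable f := by
  obtain ⟨M, hM⟩ := eventually_atTop.1 h
  have key : ∀ N, M ≤ N → ∑ n ∈ Finset.range (2 ^ N), f n
      ≤ ∑ n ∈ Finset.range (2 ^ M), f n + ∑ m ∈ Finset.range N, g m := by
    intro N hN
    induction N, hN using Nat.le_induction with
    | base => exact le_add_of_nonneg_right (Finset.sum_nonneg fun m _ => hg m)
    | succ N hN ih =>
      rw [sum_range_two_pow_succ, Finset.sum_range_succ, ← add_assoc]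
      refine add_le_add ih ?_
      calc ∑ n ∈ Finset.Ico (2 ^ N) (2 ^ (N + 1)), f n
          ≤ ∑ n ∈ Finset.Ico (2 ^ N) (2 ^ (N + 1)), g N / 2 ^ N := by
            refine Finset.sum_le_sum fun n hn => ?_
            rw [le_div_iff₀' (by positivity)]
            exact hM N hN n (Finset.mem_Ico.1 hn).1 (Finset.mem_Ico.1 hn).2
        _ = g N := by
            rw [Finset.sum_const, nsmul_eq_mul, card_Ico_two_pow]
            field_simp
  refine summable_of_sum_range_le hf (c := ∑ n ∈ Finset.range (2 ^ M), f n + ∑' m, g m) fun n => ?_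
  calc ∑ i ∈ Finset.range n, f i ≤ ∑ i ∈ Finset.range (2 ^ max M n), f i :=
        Finset.sum_le_sum_of_subset_of_nonneg
          (Finset.range_mono ((le_max_right M n).trans Nat.lt_two_pow_self.le)) fun i _ _ => hf i
    _ ≤ _ := key _ (le_max_left _ _)
    _ ≤ _ := add_le_add le_rfl (hs.sum_le_tsum _ fun m _ => hg m)

theorem summable_of_le_dyadic_block {f g : ℕ → ℝ} (hf : ∀ n, 0 ≤ f n) (hg : ∀ m, 0 ≤ g m)
    (hs : Summable f)
    (h : ∀ᶠ m in atTop, ∀ n, 2 ^ m ≤ n → n < 2 ^ (m + 1) → g m ≤ 2 ^ m * f n) :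
    Summable g := by
  obtain ⟨M, hM⟩ := eventually_atTop.1 h
  have key : ∀ N, M ≤ N → ∑ m ∈ Finset.range N, g m
      ≤ ∑ m ∈ Finset.range M, g m + ∑ n ∈ Finset.range (2 ^ N), f n := by
    intro N hN
    induction N, hN using Nat.le_induction with
    | base => exact le_add_of_nonneg_right (Finset.sum_nonneg fun m _ => hf m)
    | succ N hN ih =>
      rw [sum_range_two_pow_succ, Finset.sum_range_succ, ← add_assoc]
      refine add_le_add ih ?_
      calc g N = ∑ n ∈ Finset.Ico (2 ^ N) (2 ^ (N + 1)), g N / 2 ^ N := by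
            rw [Finset.sum_const, nsmul_eq_mul, card_Ico_two_pow]
            field_simp
        _ ≤ _ := by
            refine Finset.sum_le_sum fun n hn => ?_
            rw [div_le_iff₀' (by positivity)]
            exact hM N hN n (Finset.mem_Ico.1 hn).1 (Finset.mem_Ico.1 hn).2
  refine summable_of_sum_range_le hg (c := ∑ m ∈ Finset.range M, g m + ∑' n, f n) fun n => ?_
  calc ∑ i ∈ Finset.range n, g i ≤ ∑ i ∈ Finset.range (max M n), g i :=
        Finset.sum_le_sum_of_subset_of_nonneg
          (Finset.range_mono (le_max_right M n)) fun i _ _ => hg i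
    _ ≤ _ := key _ (le_max_left _ _)
    _ ≤ _ := add_le_add le_rfl (hs.sum_le_tsum _ fun m _ => hf m)

/-- Write `n = t * 2 ^ m` with `t` between 1 and 2; then `t ^ e ≤ 2 ^ |e|` for either sign of `e`.
-/
theorem natCast_rpow_le_of_block (e : ℝ) {m n : ℕ} (h1 : 2 ^ m ≤ n) (h2 : n < 2 ^ (m + 1)) :
    (n : ℝ) ^ e ≤ 2 ^ |e| * ((2 : ℝ) ^ e) ^ m := by
  have h1' : (2 : ℝ) ^ m ≤ n := by exact_mod_cast h1
  have h2' : (n : ℝ) ≤ 2 * 2 ^ m := by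
    rw [← pow_succ']
    exact_mod_cast h2.le
  have h0 : (0 : ℝ) < 2 ^ m := by positivity
  have ht1 : 1 ≤ (n : ℝ) / 2 ^ m := (one_le_div h0).2 h1'
  have ht2 : (n : ℝ) / 2 ^ m ≤ 2 := (div_le_iff₀ h0).2 h2'
  calc (n : ℝ) ^ e = ((n : ℝ) / 2 ^ m * 2 ^ m) ^ e := by rw [div_mul_cancel₀ _ h0.ne']
    _ = ((n : ℝ) / 2 ^ m) ^ e * (2 ^ m) ^ e := Real.mul_rpow (by positivity) h0.le
    _ ≤ 2 ^ |e| * (2 ^ m) ^ e := by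
        gcongr
        exact (Real.rpow_le_rpow_of_exponent_le ht1 (le_abs_self e)).trans
          (Real.rpow_le_rpow (by positivity) ht2 (abs_nonneg e))
    _ = _ := by rw [Real.rpow_pow_comm (by norm_num)]

theorem natCast_rpow_mem_of_block {α : ℝ} (hα : 0 ≤ α) {m n : ℕ} (h1 : 2 ^ m ≤ n)
    (h2 : n < 2 ^ (m + 1)) :
    ((2 : ℝ) ^ α) ^ m ≤ (n : ℝ) ^ α ∧ (n : ℝ) ^ α ≤ ((2 : ℝ) ^ α) ^ (m + 1) := by
  rw [Real.rpow_pow_comm (by norm_num), Real.rpow_pow_comm (by norm_num)]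
  constructor
  · exact Real.rpow_le_rpow (by positivity) (by exact_mod_cast h1) hα
  · exact Real.rpow_le_rpow (by positivity) (by exact_mod_cast h2.le) hα

end dyadic

theorem IsDyadicNorming.block_bounds {L M : ℝ → ℝ} {α ρ : ℝ} {c : ℕ → ℝ}
    (hN : IsDyadicNorming L M (2 ^ α) ρ c) (hα : 0 ≤ α) :
    ∀ᶠ m in atTop, ∀ n : ℕ, 2 ^ m ≤ n → n < 2 ^ (m + 1) →
      (n : ℝ) ^ α * M ((n : ℝ) ^ α) ≤ 3 * 2 ^ α * c m ∧
        c m ≤ 3 * ((n : ℝ) ^ α * M ((n : ℝ) ^ α)) := by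
  filter_upwards [hN.comparable] with m hm n h1 h2
  obtain ⟨h3, h4⟩ := natCast_rpow_mem_of_block hα h1 h2
  exact hm _ h3 h4

theorem IsDyadicNorming.eventually_succ_le {L M : ℝ → ℝ} {a ρ : ℝ} {c : ℕ → ℝ}
    (hN : IsDyadicNorming L M a ρ c) {b : ℝ} (hb : a < b) :
    ∀ᶠ m in atTop, c (m + 1) ≤ b * c m := by
  filter_upwards [hN.tendsto_ratio.eventually_le_const hb] with m hm
  exact (div_le_iff₀ (hN.pos m)).1 hm

/-- The exponent `(p + 2) / 4` is the midpoint of `p / 2` and 1, an interval that is nonempty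
because `p < 2`. -/
theorem exists_ratio_between {a p : ℝ} (ha : 1 < a) (hp1 : 1 ≤ p) (hp2 : p < 2) :
    ∃ ρ, 1 < ρ ∧ ρ < a ∧ a ^ p < ρ ^ 2 := by
  refine ⟨a ^ ((p + 2) / 4), Real.one_lt_rpow ha (by linarith), ?_, ?_⟩
  · calc a ^ ((p + 2) / 4) < a ^ (1 : ℝ) := Real.rpow_lt_rpow_of_exponent_lt ha (by linarith)
      _ = a := Real.rpow_one a
  · rw [← Real.rpow_natCast, ← Real.rpow_mul (by linarith)]
    exact Real.rpow_lt_rpow_of_exponent_lt ha (by push_cast; linarith)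

/-! ### The running maximum -/

section maxAbs

variable {Ω : Type*} (X : ℕ → Ω → ℝ)

theorem abs_partialSum_le_maxAbsPartialSum {j n : ℕ} (h : j ≤ n) (ω : Ω) :
    |partialSum X j ω| ≤ maxAbsPartialSum X n ω :=
  Finset.le_sup' (fun j => |partialSum X j ω|) (Finset.mem_range.2 (Nat.lt_succ_of_le h))

theorem maxAbsPartialSum_nonneg (n : ℕ) (ω : Ω) : 0 ≤ maxAbsPartialSum X n ω :=
  (abs_nonneg _).trans (abs_partialSum_le_maxAbsPartialSum X (Nat.zero_le n) ω)

theorem maxAbsPartialSum_mono {m n : ℕ} (h : m ≤ n) (ω : Ω) :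
    maxAbsPartialSum X m ω ≤ maxAbsPartialSum X n ω :=
  Finset.sup'_le _ _ fun _ hj =>
    abs_partialSum_le_maxAbsPartialSum X ((Nat.le_of_lt_succ (Finset.mem_range.1 hj)).trans h) ω

theorem exists_lt_abs_partialSum {n : ℕ} {ω : Ω} {t : ℝ} (h : t < maxAbsPartialSum X n ω) :
    ∃ j ≤ n, t < |partialSum X j ω| := by
  obtain ⟨j, hj, h'⟩ := (Finset.lt_sup'_iff _).1 h
  exact ⟨j, Nat.le_of_lt_succ (Finset.mem_range.1 hj), h'⟩

theorem abs_le_two_mul_maxAbsPartialSum (n : ℕ) (ω : Ω) :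
    |X n ω| ≤ 2 * maxAbsPartialSum X (n + 1) ω := by
  have h : X n ω = partialSum X (n + 1) ω - partialSum X n ω := by
    simp [partialSum, Finset.sum_range_succ]
  have h1 := abs_partialSum_le_maxAbsPartialSum X (le_refl (n + 1)) ω
  have h2 := abs_partialSum_le_maxAbsPartialSum X (Nat.le_succ n) ω
  rw [h]
  exact (abs_sub _ _).trans (by linarith)

end maxAbs

/-! ### The moment condition as a tail series -/

section moment

variable {L M : ℝ → ℝ} {a ρ p : ℝ} {c : ℕ → ℝ}

theorem IsDyadicNorming.eventually_pow_comparable (hN : IsDyadicNorming L M a ρ c) (ha : 0 < a)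
    (hp : 0 ≤ p) (hL : ∀ x, 0 ≤ x → 0 ≤ L x) :
    ∀ᶠ k in atTop, ∀ x, c k ≤ x → x ≤ c (k + 1) →
      (a ^ p) ^ k ≤ 6 ^ p * (x ^ p * L x ^ p) ∧
        x ^ p * L x ^ p ≤ (12 * a) ^ p * (a ^ p) ^ k := by
  filter_upwards [hN.inverse] with k hk x h1 h2
  have hx : 0 ≤ x := (hN.pos k).le.trans h1
  have hLx := hL x hx
  obtain ⟨h3, h4⟩ := hk x h1 h2
  rw [← Real.mul_rpow hx hLx, Real.rpow_pow_comm ha.le]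
  constructor
  · rw [← Real.mul_rpow (by norm_num) (mul_nonneg hx hLx)]
    exact Real.rpow_le_rpow (by positivity) h3 hp
  · rw [← Real.mul_rpow (by positivity) (by positivity)]
    exact Real.rpow_le_rpow (mul_nonneg hx hLx) h4 hp

variable {Ω : Type*} [MeasurableSpace Ω] {μ : Measure Ω} [IsProbabilityMeasure μ] {X₀ : Ω → ℝ}

/-- The moment condition is equivalent to convergence of a dyadic tail series. -/
theorem IsDyadicNorming.integrable_moment_iff (hN : IsDyadicNorming L M a ρ c) (hρ : 1 < ρ)
    (hp : 0 ≤ p) (ha : 0 < a) (hap : 2 ≤ a ^ p) (hL : ∀ x, 0 ≤ x → 0 ≤ L x)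
    (hL_meas : Measurable (fun x : Set.Ici (0 : ℝ) => L x))
    (hL_bdd : ∀ b : ℝ, ∃ C : ℝ, ∀ x : ℝ, 0 ≤ x → x ≤ b → L x ≤ C) (hX : AEMeasurable X₀ μ) :
    Integrable (fun ω => |X₀ ω| ^ p * L |X₀ ω| ^ p) μ ↔
      Summable fun k => (a ^ p) ^ k * μ.real {ω | c k < |X₀ ω|} := by
  have hcm : Monotone c := monotone_nat_of_le_succ fun k =>
    (le_mul_of_one_le_left (hN.pos k).le hρ.le).trans (hN.ratio_ge k)
  have hF0 : ∀ x, 0 ≤ x → 0 ≤ x ^ p * L x ^ p := fun x hx => by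
    have := hL x hx
    positivity
  have hev := hN.eventually_pow_comparable ha hp hL
  constructor
  · intro h
    exact summable_pow_mul_tail_of_integrable hX hcm hN.tendsto_atTop hap
      (F := fun x => x ^ p * L x ^ p) hF0 (C := 6 ^ p) (by positivity)
      (hev.mono fun k hk x h1 h2 => (hk x h1 h2).1) h
  · intro h
    refine integrable_of_summable_pow_mul_tail hX hN.tendsto_atTop (by positivity)
      (F := fun x => x ^ p * L x ^ p) hF0 ?_ (fun b => ?_) (C := (12 * a) ^ p) (by positivity)
      (hev.mono fun k hk x h1 h2 => (hk x h1 h2).2) h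
    · have h1 : Measurable fun x : ℝ => (⟨|x|, Set.mem_Ici.2 (abs_nonneg x)⟩ : Set.Ici (0 : ℝ)) :=
        (by fun_prop : Measurable fun x : ℝ => |x|).subtype_mk
      have h2 : Measurable fun x : ℝ => L |x| := hL_meas.comp h1
      exact (measurable_id.abs.pow_const p).mul (h2.pow_const p)
    · obtain ⟨C, hC⟩ := hL_bdd b
      refine ⟨b ^ p * C ^ p, fun x hx hxb => ?_⟩
      have h1 := hL x hx
      have h2 := hC x hx hxb
      have hb : 0 ≤ b := hx.trans hxb
      gcongr

end moment

/-- Control along the dyadic subsequence of indices suffices for the whole sequence. -/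
theorem IsDyadicNorming.tendsto_max_div {Ω : Type*} {X : ℕ → Ω → ℝ} {L Lt : ℝ → ℝ} {ρ : ℝ} {c : ℕ → ℝ} {α : ℝ}
    (hN : IsDyadicNorming L Lt (2 ^ α) ρ c) (hα : 0 ≤ α) {ω : Ω}
    (h : ∀ i : ℕ, ∀ᶠ m in atTop, maxAbsPartialSum X (2 ^ m) ω ≤ 1 / ((i : ℝ) + 1) * c m) :
    Tendsto (fun n : ℕ => maxAbsPartialSum X n ω / ((n : ℝ) ^ α * Lt ((n : ℝ) ^ α)))
      atTop (𝓝 0) := by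
  set a : ℝ := 2 ^ α with ha
  have ha0 : 0 < a := by positivity
  rw [Metric.tendsto_nhds]
  intro δ hδ
  -- The factor `6 * a` combines `2 * a` from `c (m + 1) ≤ 2 * a * c m` with 3 from comparing `c m`
  -- to the norming at `n`.
  obtain ⟨i, hi⟩ := exists_nat_one_div_lt (show 0 < δ / (6 * a) by positivity)
  have hev : ∀ᶠ m in atTop, ∀ n : ℕ, 2 ^ m ≤ n → n < 2 ^ (m + 1) →
      dist (maxAbsPartialSum X n ω / ((n : ℝ) ^ α * Lt ((n : ℝ) ^ α))) 0 < δ := by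
    filter_upwards [hN.block_bounds hα, hN.eventually_succ_le (show a < 2 * a by linarith),
      (tendsto_add_atTop_nat 1).eventually (h i)] with m hm hr hmax n h1 h2
    have hcm := hN.pos m
    have hc := (hm n h1 h2).2
    have hb : 0 < (n : ℝ) ^ α * Lt ((n : ℝ) ^ α) := by linarith
    rw [Real.dist_eq, sub_zero, abs_of_nonneg (div_nonneg (maxAbsPartialSum_nonneg X n ω) hb.le),
      div_lt_iff₀ hb]
    have hcm1 := hN.pos (m + 1)
    calc maxAbsPartialSum X n ω ≤ maxAbsPartialSum X (2 ^ (m + 1)) ω :=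
          maxAbsPartialSum_mono X h2.le ω
      _ ≤ 1 / ((i : ℝ) + 1) * c (m + 1) := hmax
      _ < δ / (6 * a) * c (m + 1) := mul_lt_mul_of_pos_right hi hcm1
      _ ≤ δ / (6 * a) * (2 * a * c m) := by gcongr
      _ = δ * (c m / 3) := by field_simp; norm_num
      _ ≤ _ := by
          gcongr
          linarith
  exact eventually_log_of_eventually_block (Q := fun _ n =>
    dist (maxAbsPartialSum X n ω / ((n : ℝ) ^ α * Lt ((n : ℝ) ^ α))) 0 < δ) hev

/-! ### The three implications -/

section main

variable {Ω : Type*} [MeasurableSpace Ω] {μ : Measure Ω} [IsProbabilityMeasure μ] {p : ℝ}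
  {X₀ : Ω → ℝ} {X : ℕ → Ω → ℝ} {L Lt : ℝ → ℝ}

/-- The moment condition implies convergence of the Baum–Katz series. -/
theorem summable_baumKatz_of_integrable (hp1 : 1 ≤ p) (hp2 : p < 2)
    (hindep : ∀ i j : ℕ, i ≠ j → IndepFun (X i) (X j) μ)
    (hident : ∀ n : ℕ, IdentDistrib (X n) X₀ μ μ)
    (hL : IsSlowlyVarying L) (hL_nonneg : ∀ x : ℝ, 0 ≤ x → 0 ≤ L x)
    (hL_meas : Measurable (fun x : Set.Ici (0 : ℝ) => L x))
    (hL_bdd : ∀ b : ℝ, ∃ C : ℝ, ∀ x : ℝ, 0 ≤ x → x ≤ b → L x ≤ C)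
    (hL_one : p = 1 → (∀ x : ℝ, 0 ≤ x → 1 ≤ L x) ∧ MonotoneOn L (Set.Ici 0))
    (hLt : IsDeBruijnConjugate L Lt) (hint : Integrable X₀ μ) (hmean : ∫ ω, X₀ ω ∂μ = 0)
    (hmom : Integrable (fun ω => |X₀ ω| ^ p * L |X₀ ω| ^ p) μ) {α : ℝ} (hα : 1 / p ≤ α)
    {ε : ℝ} (hε : 0 < ε) :
    Summable (fun n : ℕ => (n : ℝ) ^ (α * p - 2) *
      μ.real {ω | ε * (n : ℝ) ^ α * Lt ((n : ℝ) ^ α) < maxAbsPartialSum X n ω}) := by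
  have hp0 : 0 < p := by linarith
  have hα0 : 0 < α := (by positivity : 0 < 1 / p).trans_le hα
  have hαp : 1 ≤ α * p := (div_le_iff₀ hp0).1 hα
  set a : ℝ := 2 ^ α with ha
  have ha1 : 1 < a := Real.one_lt_rpow (by norm_num) hα0
  have ha0 : 0 < a := by linarith
  have hw : a ^ p = 2 ^ (α * p) := by rw [ha, ← Real.rpow_mul (by norm_num)]
  have hw2 : 2 ≤ a ^ p := by
    rw [hw]
    calc (2 : ℝ) = 2 ^ (1 : ℝ) := (Real.rpow_one 2).symm
      _ ≤ _ := Real.rpow_le_rpow_of_exponent_le (by norm_num) hαp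
  obtain ⟨ρ, hρ1, hρa, hρw⟩ := exists_ratio_between ha1 hp1 hp2
  obtain ⟨c, hN⟩ := exists_isDyadicNorming hL hLt hρ1 hρa
  have hX : AEMeasurable X₀ μ := hint.aemeasurable
  have hB := (hN.integrable_moment_iff hρ1 hp0.le ha0 hw2 hL_nonneg hL_meas hL_bdd hX).1 hmom
  -- For `p > 1` the ratios of `c` tend to `a < a ^ p`. For `p = 1` this strict inequality fails,
  -- and monotonicity of `L` replaces it.
  have hC : Tendsto (fun k => 2 ^ k * (∫ ω, tailAbs (c k) (X₀ ω) ∂μ) / c k) atTop (𝓝 0) := by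
    rcases hp1.eq_or_lt with hp | hp
    · subst hp
      obtain ⟨hL1, hLm⟩ := hL_one rfl
      refine tendsto_tail_of_monotoneOn hX hN.pos hN.tendsto_atTop hL1 hLm ?_
        (by simpa only [Real.rpow_one] using hmom)
      filter_upwards [hN.inverse] with k hk
      have hck : c k ≤ c (k + 1) :=
        (le_mul_of_one_le_left (hN.pos k).le hρ1.le).trans (hN.ratio_ge k)
      refine le_trans ?_ (hk (c k) le_rfl hck).1
      rw [Real.rpow_one] at hw2
      exact pow_le_pow_left₀ (by norm_num) hw2 k
    · refine tendsto_tail_of_ratio_le hX hN.pos hN.tendsto_atTop hw2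
        (hN.eventually_succ_le ?_) hB
      calc a = a ^ (1 : ℝ) := (Real.rpow_one a).symm
        _ < _ := Real.rpow_lt_rpow_of_exponent_lt ha1 hp
  have hδ : 0 < ε / (6 * a) := by positivity
  have hmain := summable_dyadic_max_partialSum hindep hident hint hmean hN.pos
    (by positivity) hρ1 hρw hN.ratio_ge hB hC hδ
  set e := α * p - 2 with he
  have hwe : a ^ p / 2 = 2 * 2 ^ e := by
    rw [hw, show α * p = e + 1 + 1 by rw [he]; ring, Real.rpow_add_one (by norm_num),
      Real.rpow_add_one (by norm_num)]
    ring
  refine summable_of_dyadic_block_le (fun n => mul_nonneg (by positivity) measureReal_nonneg)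
    (fun m => ?_) (((summable_nat_add_iff 1).2 hmain).mul_left (2 ^ |e|)) ?_
  · exact mul_nonneg (by positivity) (mul_nonneg (by positivity) measureReal_nonneg)
  filter_upwards [hN.block_bounds hα0.le, hN.eventually_succ_le (show a < 2 * a by linarith)]
    with m hm hr n h1 h2
  have hsub : μ.real {ω | ε * (n : ℝ) ^ α * Lt ((n : ℝ) ^ α) < maxAbsPartialSum X n ω}
      ≤ μ.real {ω | ∃ j < 2 ^ (m + 1), ε / (6 * a) * c (m + 1) < |partialSum X j ω|} := by
    refine measureReal_mono fun ω hω => ?_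
    obtain ⟨j, hj, hj'⟩ := exists_lt_abs_partialSum X hω
    refine ⟨j, hj.trans_lt h2, lt_of_le_of_lt ?_ hj'⟩
    rw [mul_assoc ε]
    calc ε / (6 * a) * c (m + 1) ≤ ε / (6 * a) * (2 * a * c m) := by gcongr
      _ = ε * (c m / 3) := by field_simp; ring
      _ ≤ _ := by
          have := (hm n h1 h2).2
          gcongr
          linarith
  have hQ : 0 ≤ μ.real {ω | ∃ j < 2 ^ (m + 1), ε / (6 * a) * c (m + 1) < |partialSum X j ω|} :=
    measureReal_nonneg
  calc 2 ^ m * ((n : ℝ) ^ e *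
        μ.real {ω | ε * (n : ℝ) ^ α * Lt ((n : ℝ) ^ α) < maxAbsPartialSum X n ω})
      ≤ 2 ^ m * ((2 ^ |e| * ((2 : ℝ) ^ e) ^ m) *
        μ.real {ω | ∃ j < 2 ^ (m + 1), ε / (6 * a) * c (m + 1) < |partialSum X j ω|}) := by
        have := natCast_rpow_le_of_block e h1 h2
        gcongr
    _ = 2 ^ |e| * ((a ^ p / 2) ^ m *
        μ.real {ω | ∃ j < 2 ^ (m + 1), ε / (6 * a) * c (m + 1) < |partialSum X j ω|}) := by
        rw [hwe, mul_pow]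
        ring
    -- The block of `n` ends at `2 ^ (m + 1)`, so the event has index `m + 1`; raising the weight to
    -- that power is harmless because `a ^ p / 2 ≥ 1`.
    _ ≤ _ := by
        gcongr
        · linarith
        · omega

/-- Convergence of the series with weights `1 / n` gives the almost sure convergence. -/
theorem ae_tendsto_of_summable_inv_mul (hL : IsSlowlyVarying L)
    (hLt : IsDeBruijnConjugate L Lt) {α : ℝ} (hα : 0 < α)
    (h : ∀ ε : ℝ, 0 < ε → Summable (fun n : ℕ => (n : ℝ)⁻¹ *
      μ.real {ω | ε * (n : ℝ) ^ α * Lt ((n : ℝ) ^ α) < maxAbsPartialSum X n ω})) :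
    ∀ᵐ ω ∂μ, Tendsto
      (fun n : ℕ => maxAbsPartialSum X n ω / ((n : ℝ) ^ α * Lt ((n : ℝ) ^ α))) atTop (𝓝 0) := by
  set a : ℝ := 2 ^ α with ha
  have ha1 : 1 < a := Real.one_lt_rpow (by norm_num) hα
  have ha0 : 0 < a := by linarith
  obtain ⟨ρ, hρ1, hρa⟩ := exists_between ha1
  obtain ⟨c, hN⟩ := exists_isDyadicNorming hL hLt hρ1 hρa
  have hBC : ∀ i : ℕ, ∀ᵐ ω ∂μ, ∀ᶠ m in atTop,
      maxAbsPartialSum X (2 ^ m) ω ≤ 1 / ((i : ℝ) + 1) * c m := by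
    intro i
    set η := 1 / ((i : ℝ) + 1) with hη
    have hη0 : 0 < η := by positivity
    have hsum : Summable fun m => 1 / 2 * μ.real {ω | η * c m < maxAbsPartialSum X (2 ^ m) ω} := by
      refine summable_of_le_dyadic_block
        (fun n => mul_nonneg (by positivity) measureReal_nonneg)
        (fun m => mul_nonneg (by positivity) measureReal_nonneg)
        (h (η / (3 * a)) (by positivity)) ?_
      filter_upwards [hN.block_bounds hα.le] with m hm n h1 h2
      have hn0 : (0 : ℝ) < n := by
        have : 0 < 2 ^ m := by positivity
        exact_mod_cast this.trans_le h1
      rw [← mul_assoc]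
      -- This is where the constant 1/2 in front of the dyadic series comes from: `n ≤ 2 ^ (m + 1)`
      -- on the block.
      have hn : 1 / 2 ≤ (2 : ℝ) ^ m * (n : ℝ)⁻¹ := by
        rw [← div_eq_mul_inv, div_le_div_iff₀ (by norm_num) hn0, one_mul, ← pow_succ]
        exact_mod_cast h2.le
      refine mul_le_mul hn (measureReal_mono fun ω hω => ?_) measureReal_nonneg (by positivity)
      simp only [Set.mem_ofPred_eq] at hω ⊢
      calc η / (3 * a) * (n : ℝ) ^ α * Lt ((n : ℝ) ^ α)
          = η / (3 * a) * ((n : ℝ) ^ α * Lt ((n : ℝ) ^ α)) := by ring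
        _ ≤ η / (3 * a) * (3 * a * c m) := by
            exact mul_le_mul_of_nonneg_left (hm n h1 h2).1 (by positivity)
        _ = η * c m := by field_simp
        _ < _ := hω
        _ ≤ _ := maxAbsPartialSum_mono X h1 ω
    have hsum' := (summable_mul_left_iff (by norm_num : (1 / 2 : ℝ) ≠ 0)).1 hsum
    have hfin : ∑' m, μ {ω | η * c m < maxAbsPartialSum X (2 ^ m) ω} ≠ ⊤ := by
      have heq : ∑' m, μ {ω | η * c m < maxAbsPartialSum X (2 ^ m) ω}
          = ∑' m, ENNReal.ofReal (μ.real {ω | η * c m < maxAbsPartialSum X (2 ^ m) ω}) :=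
        tsum_congr fun m => (ofReal_measureReal (measure_ne_top _ _)).symm
      rw [heq]
      exact hsum'.tsum_ofReal_ne_top
    filter_upwards [ae_eventually_notMem hfin] with ω hω
    exact hω.mono fun m hm => not_lt.1 hm
  filter_upwards [ae_all_iff.2 hBC] with ω hω
  exact hN.tendsto_max_div hα.le hω

/-- The almost sure convergence implies the moment condition and that `X₀` is centred. -/
theorem integrable_of_ae_tendsto (hp1 : 1 ≤ p) (hp2 : p < 2)
    (hindep : ∀ i j : ℕ, i ≠ j → IndepFun (X i) (X j) μ)
    (hident : ∀ n : ℕ, IdentDistrib (X n) X₀ μ μ)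
    (hL : IsSlowlyVarying L) (hL_nonneg : ∀ x : ℝ, 0 ≤ x → 0 ≤ L x)
    (hL_meas : Measurable (fun x : Set.Ici (0 : ℝ) => L x))
    (hL_bdd : ∀ b : ℝ, ∃ C : ℝ, ∀ x : ℝ, 0 ≤ x → x ≤ b → L x ≤ C)
    (hL_one : p = 1 → (∀ x : ℝ, 0 ≤ x → 1 ≤ L x) ∧ MonotoneOn L (Set.Ici 0))
    (hLt : IsDeBruijnConjugate L Lt)
    (h : ∀ᵐ ω ∂μ, Tendsto
      (fun n : ℕ => maxAbsPartialSum X n ω / ((n : ℝ) ^ (1 / p) * Lt ((n : ℝ) ^ (1 / p))))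
      atTop (𝓝 0)) :
    (Integrable X₀ μ ∧ ∫ ω, X₀ ω ∂μ = 0) ∧
      Integrable (fun ω => |X₀ ω| ^ p * L |X₀ ω| ^ p) μ := by
  have hp0 : 0 < p := by linarith
  set α := 1 / p with hα
  have hα0 : 0 < α := by positivity
  set a : ℝ := 2 ^ α with ha
  have ha1 : 1 < a := Real.one_lt_rpow (by norm_num) hα0
  have ha0 : 0 < a := by linarith
  have hw : a ^ p = 2 := by
    rw [ha, ← Real.rpow_mul (by norm_num), hα, one_div_mul_cancel hp0.ne', Real.rpow_one]
  obtain ⟨ρ, hρ1, hρa, -⟩ := exists_ratio_between ha1 hp1 hp2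
  obtain ⟨c, hN⟩ := exists_isDyadicNorming hL hLt hρ1 hρa
  have hX : AEMeasurable X₀ μ := (hident 0).aemeasurable_snd
  have hbounds := hN.block_bounds hα0.le
  have hmaxc : ∀ δ : ℝ, 0 < δ → ∀ᵐ ω ∂μ, ∀ᶠ n : ℕ in atTop,
      maxAbsPartialSum X n ω ≤ δ * c (Nat.log 2 n) := by
    intro δ hδ
    filter_upwards [h] with ω hω
    filter_upwards [hω.eventually_le_const (show (0 : ℝ) < δ / (3 * a) by positivity),
      eventually_log_of_eventually_block (Q := fun m n =>
        (n : ℝ) ^ α * Lt ((n : ℝ) ^ α) ≤ 3 * 2 ^ α * c m ∧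
        c m ≤ 3 * ((n : ℝ) ^ α * Lt ((n : ℝ) ^ α))) hbounds] with n hn hb
    have hcm := hN.pos (Nat.log 2 n)
    have hb0 : 0 < (n : ℝ) ^ α * Lt ((n : ℝ) ^ α) := by linarith [hb.2]
    rw [div_le_iff₀ hb0] at hn
    calc _ ≤ δ / (3 * a) * ((n : ℝ) ^ α * Lt ((n : ℝ) ^ α)) := hn
      _ ≤ δ / (3 * a) * (3 * a * c (Nat.log 2 n)) := by
          exact mul_le_mul_of_nonneg_left hb.1 (by positivity)
      _ = _ := by field_simp
  have htail : Summable fun m => 2 ^ m * μ.real {ω | c m < |X₀ ω|} := by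
    have hBC := summable_measureReal_of_pairwise_indep hindep hident
      (B := fun n => {x | c (Nat.log 2 (n + 1)) < |x|})
      (fun n => measurableSet_lt measurable_const (by fun_prop)) (by
        -- The constant 1/2 cancels the 2 in `|X_n| ≤ 2 max`. Indexing from 0, `X n` first enters
        -- the sum of `n + 1` terms, hence the shift.
        filter_upwards [hmaxc (1 / 2) (by norm_num)] with ω hω
        filter_upwards [(tendsto_add_atTop_nat 1).eventually hω] with n hn
        have := abs_le_two_mul_maxAbsPartialSum X n ω
        exact not_lt.2 (by linarith))
    have hBC' : Summable fun n => μ.real {ω | c (Nat.log 2 n) < |X₀ ω|} :=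
      (summable_nat_add_iff 1).1 hBC
    refine summable_of_le_dyadic_block (fun n => measureReal_nonneg)
      (fun m => mul_nonneg (by positivity) measureReal_nonneg) hBC'
      (Eventually.of_forall fun m n h1 h2 => ?_)
    rw [Nat.log_eq_of_pow_le_of_lt_pow h1 h2]
  have hmom := (hN.integrable_moment_iff hρ1 hp0.le ha0 hw.ge hL_nonneg hL_meas hL_bdd hX).2
    (by rwa [hw])
  -- For `p = 1`, `L ≥ 1` gives integrability from the moment and bounds `Lt` along `a ^ m`. For `p
  -- > 1`, `a < 2` makes `c` grow eventually by at most 2 per step, so the tail series bounds the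
  -- first moment.
  have hgrow : Integrable X₀ μ ∧ ∃ C : ℝ, 0 < C ∧ ∀ᶠ m in atTop, c m ≤ C * 2 ^ m := by
    rcases hp1.eq_or_lt with hp | hp
    · subst hp
      obtain ⟨hL1, -⟩ := hL_one rfl
      simp only [Real.rpow_one] at hmom
      refine ⟨hmom.mono' hX.aestronglyMeasurable (ae_of_all _ fun ω => ?_), 2, two_pos, ?_⟩
      · exact le_mul_of_one_le_right (abs_nonneg _) (hL1 _ (abs_nonneg _))
      · rw [Real.rpow_one] at hw
        have hpow : Tendsto (fun m : ℕ => a ^ m) atTop atTop :=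
          tendsto_pow_atTop_atTop_of_one_lt ha1
        filter_upwards [hN.eventually_eq,
          (hLt.2.2.comp hpow).eventually_le_const (show (1 : ℝ) < 2 by norm_num)] with m hm h2
        simp only [Function.comp] at h2
        rw [← hm] at h2
        have hcm := hN.pos m
        have hLt0 : 0 ≤ Lt (a ^ m) := by
          rw [hm] at hcm
          exact (pos_of_mul_pos_right hcm (by positivity)).le
        have h3 : Lt (a ^ m) ≤ 2 := (le_mul_of_one_le_right hLt0 (hL1 _ hcm.le)).trans h2
        calc c m = a ^ m * Lt (a ^ m) := hm
          _ ≤ a ^ m * 2 := by gcongr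
          _ = 2 * 2 ^ m := by rw [hw]; ring
    · have ha2 : a < 2 := by
        calc a < a ^ p := by
              calc a = a ^ (1 : ℝ) := (Real.rpow_one a).symm
                _ < _ := Real.rpow_lt_rpow_of_exponent_lt ha1 hp
          _ = 2 := hw
      obtain ⟨K, hK⟩ := eventually_atTop.1 (hN.eventually_succ_le ha2)
      have hcK := hN.pos K
      refine ⟨?_, c K, hcK, ?_⟩
      · have htl := (integrable_tailAbs_and_integral_le hX hN.pos hN.tendsto_atTop two_pos hK
          htail).1
        refine ((integrable_const (c K)).add htl).mono' hX.aestronglyMeasurable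
          (ae_of_all _ fun ω => ?_)
        simp only [Pi.add_apply, Real.norm_eq_abs, tailAbs]
        split_ifs with h1 <;> linarith
      · filter_upwards [eventually_ge_atTop K] with m hm
        induction m, hm using Nat.le_induction with
        | base => exact le_mul_of_one_le_right hcK.le (one_le_pow₀ (by norm_num))
        | succ m hm ih =>
          calc c (m + 1) ≤ 2 * c m := hK m hm
            _ ≤ 2 * (c K * 2 ^ m) := by gcongr
            _ = _ := by ring
  obtain ⟨hint, C, hC0, hC⟩ := hgrow
  refine ⟨⟨hint, ?_⟩, hmom⟩
  have hslln := strong_law_ae_real X ((hident 0).integrable_iff.2 hint)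
    (fun i j hij => hindep i j hij) (fun i => (hident i).trans (hident 0).symm)
  rw [(hident 0).integral_eq] at hslln
  have hall : ∀ᵐ ω ∂μ, ∀ i : ℕ, ∀ᶠ n : ℕ in atTop,
      maxAbsPartialSum X n ω ≤ 1 / ((i : ℝ) + 1) * c (Nat.log 2 n) :=
    ae_all_iff.2 fun i => hmaxc _ (by positivity)
  obtain ⟨ω, hω1, hω2⟩ := (hslln.and hall).exists
  have hpow2 : Tendsto (fun m : ℕ => 2 ^ m) atTop atTop :=
    tendsto_pow_atTop_atTop_of_one_lt one_lt_two
  have hsub := (hω1.comp hpow2).abs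
  -- Along `n = 2 ^ m` the averages tend to the mean, yet are at most `c m / ((i + 1) * 2 ^ m) ≤ C /
  -- (i + 1)` for every `i`.
  have hzero : |∫ ω, X₀ ω ∂μ| ≤ 0 := by
    refine le_of_forall_pos_le_add fun δ hδ => ?_
    obtain ⟨i, hi⟩ := exists_nat_one_div_lt (show 0 < δ / C by positivity)
    refine le_of_tendsto hsub ?_
    filter_upwards [hpow2.eventually (hω2 i), hC] with m hm hcm
    rw [Nat.log_pow (by norm_num)] at hm
    simp only [Function.comp, zero_add]
    push_cast
    rw [abs_div, abs_of_pos (show (0 : ℝ) < 2 ^ m by positivity), div_le_iff₀ (by positivity)]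
    have hcm0 := hN.pos m
    calc |∑ i ∈ Finset.range (2 ^ m), X i ω| ≤ maxAbsPartialSum X (2 ^ m) ω :=
          abs_partialSum_le_maxAbsPartialSum X le_rfl ω
      _ ≤ 1 / ((i : ℝ) + 1) * c m := hm
      _ ≤ δ / C * (C * 2 ^ m) := by gcongr
      _ = _ := by field_simp
  exact abs_nonpos_iff.1 hzero

end main

theorem theorem1 {Ω : Type*} [MeasurableSpace Ω] (μ : Measure Ω) [IsProbabilityMeasure μ]
    (p : ℝ) (hp1 : 1 ≤ p) (hp2 : p < 2)
    (X₀ : Ω → ℝ) (X : ℕ → Ω → ℝ)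
    (hindep : ∀ i j : ℕ, i ≠ j → IndepFun (X i) (X j) μ)
    (hident : ∀ n : ℕ, IdentDistrib (X n) X₀ μ μ)
    (L Lt : ℝ → ℝ)
    (hL : IsSlowlyVarying L)
    (hL_nonneg : ∀ x : ℝ, 0 ≤ x → 0 ≤ L x)
    (hL_meas : Measurable (fun x : Set.Ici (0 : ℝ) => L x))
    (hL_bdd : ∀ b : ℝ, ∃ C : ℝ, ∀ x : ℝ, 0 ≤ x → x ≤ b → L x ≤ C)
    (hL_one : p = 1 → (∀ x : ℝ, 0 ≤ x → 1 ≤ L x) ∧ MonotoneOn L (Set.Ici 0))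
    (hLt : IsDeBruijnConjugate L Lt) :
    List.TFAE [
      (Integrable X₀ μ ∧ ∫ ω, X₀ ω ∂μ = 0) ∧
        Integrable (fun ω => |X₀ ω| ^ p * L |X₀ ω| ^ p) μ,
      ∀ α : ℝ, 1 / p ≤ α → ∀ ε : ℝ, 0 < ε →
        Summable (fun n : ℕ => (n : ℝ) ^ (α * p - 2) *
          μ.real {ω | ε * (n : ℝ) ^ α * Lt ((n : ℝ) ^ α) < maxAbsPartialSum X n ω}),
      ∀ᵐ ω ∂μ, Tendsto
        (fun n : ℕ => maxAbsPartialSum X n ω / ((n : ℝ) ^ (1 / p) * Lt ((n : ℝ) ^ (1 / p))))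
        atTop (𝓝 0)] := by
  have hp0 : 0 < p := by linarith
  tfae_have 1 → 2 := fun h α hα ε hε =>
    summable_baumKatz_of_integrable hp1 hp2 hindep hident hL hL_nonneg hL_meas hL_bdd hL_one hLt
      h.1.1 h.1.2 h.2 hα hε
  tfae_have 2 → 3 := fun h => by
    refine ae_tendsto_of_summable_inv_mul hL hLt (by positivity) fun ε hε => ?_
    have h1 := h (1 / p) le_rfl ε hε
    rw [one_div_mul_cancel hp0.ne', show (1 : ℝ) - 2 = -1 by norm_num] at h1
    simpa only [Real.rpow_neg_one] using h1
  tfae_have 3 → 1 := integrable_of_ae_tendsto hp1 hp2 hindep hident hL hL_nonneg hL_meas hL_bdd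
    hL_one hLt
  tfae_finish
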